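/- Let $m,p\ge 1$, $n=m+p$, and let $\Lambda=\mathrm{diag}(\lambda_1,\dots,\lambda_n)$ with $\lambda_i\in C^1([0,1])$ and $$\lambda_1(x)<\cdots<\lambda_m(x)<0<\lambda_{m+1}(x)<\cdots<\lambda_n(x)\qquad (x\in[0,1]).$$ For $v\in\mathbb R^n$ write $v=(v_-,v_+)$ with $v_-\in\mathbb R^m$, $v_+\in\mathbb R^{p}$. Let $Q\in\mathbb R^{p\times m}$, and let $$G=\begin{pmatrix}G_1&0\\ G_2&0\end{pmatrix}\in L^\infty(0,1)^{n\times n},\qquad \widetilde G=\begin{pmatrix}0&0\\ G_2&0\end{pmatrix},$$ where $G_1=(g_{ij})$ is $m\times m$ and strictly lower triangular ($g_{ij}=0$ for $j\ge i$). For $A\in L^\infty(0,1)^{n\times n}$ and a bounded linear map $H:L^2(0,1)^n\to\mathbb R^m$, consider the system $$(S_{A,H})\qquad u_t+\Lambda(x)u_x=A(x)\,u(t,0),\quad u_-(t,1)=H(u(t)),\quad u_+(t,0)=Q\,u_-(t,0),\qquad t>0,\ x\in(0,1).$$ A weak solution of $(S_{A,H})$ is a function $u\in C^0([0,\infty);L^2(0,1)^n)$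 for which there are traces $a=u(\cdot,0)$ and $b=u(\cdot,1)$ in $L^2_{\mathrm{loc}}([0,\infty))^n$ with $b_-(t)=H(u(t))$ and $a_+(t)=Q\,a_-(t)$ for a.e. $t>0$, such that for every $i$, every $\tau\ge 0$ and every $\theta\in C^1([0,\tau]\times[0,1])$ $$\int_0^1\theta(\tau,x)u_i(\tau,x)\,dx-\int_0^1\theta(0,x)u_i(0,x)\,dx=\int_0^\tau\!\!\int_0^1\big(\theta_t+(\lambda_i\theta)_x\big)u_i\,dx\,dt+\int_0^\tau\big(\lambda_i(0)\theta(t,0)a_i(t)-\lambda_i(1)\theta(t,1)b_i(t)\big)dt+\int_0^\tau\!\!\int_0^1\theta(t,x)\big(A(x)a(t)\big)_i\,dx\,dt.$$ Put $\phi_i(x)=\int_0^x\frac{d\xi}{\lambda_i(\xi)}$ for $1\le i\le m$, which is a decreasing bijection from $[0,1]$ onto $[\phi_i(1),0]$. Let $K=(k_{ij})_{1\le i,j\le n}$ be the kernel on $[0,1]^2$ given by $$k_{ij}(x,y)=\frac{g_{ij}\big(\phi_i^{-1}(\phi_i(x)-\phi_j(y))\big)}{-\lambda_j(y)}\quad\text{if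 } 1\le j<i\le m \text{ and } \phi_i(x)\le\phi_j(y),$$ and $k_{ij}(x,y)=0$ in all other cases. (Thus $K$ vanishes outside its first $m$ rows and columns and is strictly lower triangular.) Then $K\in L^2((0,1)^2)^{n\times n}$, the formula $$\mathcal F z(x)=z(x)-\int_0^1K(x,y)z(y)\,dy$$ defines an invertible bounded linear map $\mathcal F:L^2(0,1)^n\to L^2(0,1)^n$ (with bounded inverse), and there exists a bounded linear map $H:L^2(0,1)^n\to\mathbb R^m$ such that, for every $\gamma^0\in L^2(0,1)^n$, if $z$ is the weak solution of $(S_{\widetilde G,0})$ with $z(0)=\mathcal F^{-1}\gamma^0$, then $\gamma(t)=\mathcal F z(t)$ is a weak solution of $(S_{G,H})$ with $\gamma(0)=\gamma^0$, and it is the only one. -/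

import Mathlib

open MeasureTheory Set

noncomputable section

namespace HyperbolicFredholm

/-- Lebesgue measure on the interval `(0,1)`. -/
abbrev unitMeasure : Measure ℝ := volume.restrict (Ioo (0 : ℝ) 1)

/-- Index set of the `n = m + p` components: `Sum.inl` for the `m` components with negative speed,
`Sum.inr` for the `p = n - m` components with positive speed. -/
abbrev Idx (m p : ℕ) : Type := Fin m ⊕ Fin p

/-- The state space `L²(0,1)ⁿ`, with its product topology. -/
abbrev State (m p : ℕ) : Type := Idx m p → Lp ℝ 2 unitMeasure

/-- Assumptions on the speeds `λ₁ < ⋯ < λₘ < 0 < λₘ₊₁ < ⋯ < λₙ`, of class `C¹` on `[0,1]`. -/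
structure IsSpeedFamily {m p : ℕ} (lam : Idx m p → ℝ → ℝ) : Prop where
  contDiffOn : ∀ i, ContDiffOn ℝ 1 (lam i) (Icc 0 1)
  neg : ∀ i : Fin m, ∀ x ∈ Icc (0 : ℝ) 1, lam (Sum.inl i) x < 0
  pos : ∀ k : Fin p, ∀ x ∈ Icc (0 : ℝ) 1, 0 < lam (Sum.inr k) x
  lt_neg : ∀ i j : Fin m, i < j → ∀ x ∈ Icc (0 : ℝ) 1, lam (Sum.inl i) x < lam (Sum.inl j) x
  lt_pos : ∀ k l : Fin p, k < l → ∀ x ∈ Icc (0 : ℝ) 1, lam (Sum.inr k) x < lam (Sum.inr l) x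

/-- Assumptions on the coupling matrix: `L^∞(0,1)` entries, and the block form
`G = [[G₁, 0], [G₂, 0]]` with `G₁` strictly lower triangular. -/
structure IsCascadeMatrix {m p : ℕ} (G : Idx m p → Idx m p → ℝ → ℝ) : Prop where
  memLp : ∀ i j, MemLp (G i j) ⊤ unitMeasure
  right_eq_zero : ∀ (i : Idx m p) (l : Fin p) (x : ℝ), G i (Sum.inr l) x = 0
  upper_eq_zero : ∀ i j : Fin m, i ≤ j → ∀ x : ℝ, G (Sum.inl i) (Sum.inl j) x = 0

/-- The matrix `[[0, 0], [G₂, 0]]` obtained from `G = [[G₁, 0], [G₂, 0]]`. -/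
def reducedMatrix {m p : ℕ} (G : Idx m p → Idx m p → ℝ → ℝ) : Idx m p → Idx m p → ℝ → ℝ
  | Sum.inl _, _ => fun _ => 0
  | Sum.inr k, Sum.inl j => G (Sum.inr k) (Sum.inl j)
  | Sum.inr _, Sum.inr _ => fun _ => 0

/-- `φ(x) = ∫₀ˣ dξ / λ(ξ)`. -/
def travel (l : ℝ → ℝ) (x : ℝ) : ℝ := ∫ ξ in (0 : ℝ)..x, 1 / l ξ

/-- The inverse of `φ : [0,1] → φ([0,1])`. -/
def travelInv (l : ℝ → ℝ) : ℝ → ℝ := Function.invFunOn (travel l) (Icc 0 1)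

/-- Weak form, for one component, of `u_t + l(x) u_x = f(t,x)` on `(0,∞) × (0,1)` with
`u(·,0) = a` and `u(·,1) = b`: Green's formula on `(0,τ) × (0,1)` against every test function `θ`
of class `C¹` on `[0,τ] × [0,1]`. -/
def WeakTransport (l : ℝ → ℝ) (u : ℝ → Lp ℝ 2 unitMeasure) (a b : ℝ → ℝ) (f : ℝ → ℝ → ℝ) : Prop :=
  ∀ τ : ℝ, 0 ≤ τ → ∀ θ : ℝ → ℝ → ℝ,
    ContDiffOn ℝ 1 (Function.uncurry θ) (Icc 0 τ ×ˢ Icc 0 1) →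
    (∫ x, θ τ x * u τ x ∂unitMeasure) - (∫ x, θ 0 x * u 0 x ∂unitMeasure) =
      (∫ t in (0 : ℝ)..τ, ∫ x,
          (deriv (fun s => θ s x) t + deriv (fun y => l y * θ t y) x) * u t x ∂unitMeasure)
      + (∫ t in (0 : ℝ)..τ, (l 0 * θ t 0 * a t - l 1 * θ t 1 * b t))
      + ∫ t in (0 : ℝ)..τ, ∫ x, θ t x * f t x ∂unitMeasure

/-- `u ∈ C⁰([0,∞); L²(0,1)ⁿ)` is a weak solution of
`u_t + Λ(x) u_x = G(x) u(t,0)`, `u₋(t,1) = H(u(t))`, `u₊(t,0) = Q u₋(t,0)`.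
Here `a = u(·,0)` and `b = u(·,1)` are the boundary traces of `u`, in `L²_loc`; by the weak form
they are determined by `u` up to null sets. The initial datum is `u 0`. -/
def IsWeakSolution {m p : ℕ} (lam : Idx m p → ℝ → ℝ) (G : Idx m p → Idx m p → ℝ → ℝ)
    (Q : Matrix (Fin p) (Fin m) ℝ) (H : State m p →L[ℝ] (Fin m → ℝ))
    (u : ℝ → State m p) : Prop :=
  ContinuousOn u (Ici 0) ∧
  ∃ a b : Idx m p → ℝ → ℝ,
    (∀ i, ∀ T : ℝ, MemLp (a i) 2 (volume.restrict (Ioo 0 T)) ∧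
      MemLp (b i) 2 (volume.restrict (Ioo 0 T))) ∧
    (∀ i, WeakTransport (lam i) (fun t => u t i) (a i) (b i)
      (fun t x => ∑ j, G i j x * a j t)) ∧
    (∀ᵐ t ∂volume.restrict (Ioi (0 : ℝ)), ∀ i : Fin m, b (Sum.inl i) t = H (u t) i) ∧
    (∀ᵐ t ∂volume.restrict (Ioi (0 : ℝ)), ∀ k : Fin p,
      a (Sum.inr k) t = ∑ j : Fin m, Q k j * a (Sum.inl j) t)

end HyperbolicFredholm

end

noncomputable section

namespace HyperbolicFredholm

open Filter Topology

/-! Everything rests on explicit transport along characteristics. With `φ = travel l`, a solution of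
`u_t + l u_x = 0` is a function of `t - φ(x)`. In the target system the components with negative
speed have no source and zero inflow at `x = 1`, so `z_j(t,x) = α_j(t - φ_j(x))`, where `α_j` is at
once the trace at `x = 0` and the initial datum read by exit time (`exitProfile`,
`WeakTransport.eq_exitProfile`, `WeakTransport.left_trace_eq_exitProfile`).

The kernel is designed so that, after the substitution `φ_i(ξ) = φ_i(x) - φ_j(y)`, the integral `∫
k_ij(x,y) z_j(t,y) dy` becomes the Duhamel integral `w = ∫₀ˣ (g_ij(ξ) / -λ_i(ξ)) α_j(t + φ_i(ξ) -
φ_i(x)) dξ` (`integral_cascadeKernel_eq_duhamel`). Formally `w_t + λ_i w_x = -g_ij(x) α_j(t)` and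
`w(t,0) = 0`. Subtracting these integrals from `z_i` therefore creates exactly the sources of the
original system and does not change the trace at `x = 0`; hence `Q` and `G₂` act as before. The
values `w(t,1)` are bounded functionals of `z`, and composing them with `F⁻¹` gives `H`. The weak
form of this computation is `IsTransport.cascade`. It comes from Green's formula for one smooth wave
starting at `ξ` (`green_travelling_wave`), integration over `ξ`, and approximation of `α` in `L¹`
(`IsSpeed.green_duhamel`).

`F` is the identity minus a strictly triangular, hence nilpotent, operator matrix, so it is
invertible. Uniqueness follows the same triangular order: `H_i` depends only on components before
`i`, so the difference of two solutions satisfies, component after component, a homogeneous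
transport equation with zero inflow and zero initial datum (`IsWeakSolution.eq_of_initial_eq`). -/

/-! ### Travel time on the whole line and its inverse. -/

/-- The continuous extension of a speed from `[0,1]` to `ℝ` that is constant on both sides. -/
def speedExt (l : ℝ → ℝ) (x : ℝ) : ℝ := l (projIcc 0 1 zero_le_one x)

/-- The travel time of the extended speed, a homeomorphism of `ℝ`. -/
def travelExt (l : ℝ → ℝ) (x : ℝ) : ℝ := travel (speedExt l) x

/-- The inverse of `travelExt`. -/
def position (l : ℝ → ℝ) : ℝ → ℝ := Function.invFun (travelExt l)

lemma speedExt_of_mem (l : ℝ → ℝ) {x : ℝ} (hx : x ∈ Icc (0 : ℝ) 1) : speedExt l x = l x := by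
  simp [speedExt, projIcc_of_mem zero_le_one hx]

lemma continuous_speedExt {l : ℝ → ℝ} (hl : ContinuousOn l (Icc 0 1)) :
    Continuous (speedExt l) :=
  (continuousOn_iff_continuous_domRestrict.1 hl).comp continuous_projIcc

lemma travelExt_of_mem (l : ℝ → ℝ) {x : ℝ} (hx : x ∈ Icc (0 : ℝ) 1) :
    travelExt l x = travel l x := by
  unfold travelExt travel
  refine intervalIntegral.integral_congr fun y hy => ?_
  rw [uIcc_of_le hx.1] at hy
  simp only [speedExt_of_mem l ⟨hy.1, hy.2.trans hx.2⟩]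

lemma travelExt_zero (l : ℝ → ℝ) : travelExt l 0 = 0 := by
  simp [travelExt, travel]

/-- A continuous speed on `[0,1]` of constant sign. -/
structure IsSpeed (l : ℝ → ℝ) : Prop where
  continuousOn : ContinuousOn l (Icc 0 1)
  sign : (∀ x ∈ Icc (0 : ℝ) 1, l x < 0) ∨ ∀ x ∈ Icc (0 : ℝ) 1, 0 < l x

namespace IsSpeed

variable {l : ℝ → ℝ} (hl : IsSpeed l)
include hl

lemma ne_zero {x : ℝ} (hx : x ∈ Icc (0 : ℝ) 1) : l x ≠ 0 := by
  rcases hl.sign with h | h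
  · exact (h x hx).ne
  · exact (h x hx).ne'

lemma continuous_ext : Continuous (speedExt l) := continuous_speedExt hl.continuousOn

lemma ext_ne_zero (x : ℝ) : speedExt l x ≠ 0 := hl.ne_zero (projIcc 0 1 zero_le_one x).2

lemma hasDerivAt_travelExt (x : ℝ) : HasDerivAt (travelExt l) (speedExt l x)⁻¹ x := by
  have hc : Continuous fun y => 1 / speedExt l y :=
    continuous_const.div hl.continuous_ext hl.ext_ne_zero
  have := intervalIntegral.integral_hasDerivAt_right (hc.intervalIntegrable 0 x)
    hc.aestronglyMeasurable.stronglyMeasurableAtFilter hc.continuousAt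
  rwa [one_div] at this

lemma continuous_travelExt : Continuous (travelExt l) :=
  continuous_iff_continuousAt.2 fun x => (hl.hasDerivAt_travelExt x).continuousAt

lemma contDiff_travelExt : ContDiff ℝ 1 (travelExt l) := by
  rw [contDiff_one_iff_deriv]
  refine ⟨fun x => (hl.hasDerivAt_travelExt x).differentiableAt, ?_⟩
  rw [funext fun x => (hl.hasDerivAt_travelExt x).deriv]
  exact hl.continuous_ext.inv₀ hl.ext_ne_zero

lemma neg : IsSpeed (fun x => -l x) :=
  ⟨hl.continuousOn.neg, hl.sign.symm.imp (fun h x hx => neg_neg_of_pos (h x hx))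
    (fun h x hx => neg_pos_of_neg (h x hx))⟩

end IsSpeed

lemma travelExt_neg (l : ℝ → ℝ) (x : ℝ) : travelExt (fun x => -l x) x = -travelExt l x := by
  simp only [travelExt, travel, speedExt, ← intervalIntegral.integral_neg]
  congr 1
  ext y
  rw [div_neg]

lemma exists_bound_speedExt {l : ℝ → ℝ} (hl : ContinuousOn l (Icc 0 1)) :
    ∃ C : ℝ, 0 < C ∧ ∀ x, |speedExt l x| ≤ C := by
  obtain ⟨C, hC⟩ := isCompact_Icc.exists_bound_of_continuousOn hl
  refine ⟨max C 1, by positivity, fun x => le_max_of_le_left ?_⟩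
  exact hC _ (projIcc 0 1 zero_le_one x).2

/-- The extended speed is bounded by some `C`, so the travel time has slope at least `C⁻¹`
everywhere; this linear growth in both directions gives surjectivity onto `ℝ`. -/
lemma travelExt_strictMono_surjective {l : ℝ → ℝ} (hl : IsSpeed l)
    (hpos : ∀ x ∈ Icc (0 : ℝ) 1, 0 < l x) :
    StrictMono (travelExt l) ∧ Function.Surjective (travelExt l) := by
  have hp : ∀ x, 0 < speedExt l x := fun x => hpos _ (projIcc 0 1 zero_le_one x).2
  obtain ⟨C, hC, hb⟩ := exists_bound_speedExt hl.continuousOn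
  have hm : StrictMono (travelExt l) := strictMono_of_deriv_pos fun x => by
    rw [(hl.hasDerivAt_travelExt x).deriv]
    exact inv_pos.2 (hp x)
  have hmono : Monotone fun x => travelExt l x - C⁻¹ * x := by
    refine monotone_of_hasDerivAt_nonneg (f' := fun x => (speedExt l x)⁻¹ - C⁻¹ * 1)
      (fun x => (hl.hasDerivAt_travelExt x).sub ((hasDerivAt_id x).const_mul _)) fun x => ?_
    have : C⁻¹ ≤ (speedExt l x)⁻¹ := inv_anti₀ (hp x) ((le_abs_self _).trans (hb x))
    simpa using this
  refine ⟨hm, hl.continuous_travelExt.surjective ?_ ?_⟩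
  · refine tendsto_atTop_mono' _ ?_ (tendsto_id.const_mul_atTop (inv_pos.2 hC))
    filter_upwards [eventually_ge_atTop 0] with x hx
    have := hmono hx
    simp only [travelExt_zero, mul_zero, sub_zero] at this
    simpa using this
  · refine tendsto_atBot_mono' _ ?_ (tendsto_id.const_mul_atBot (inv_pos.2 hC))
    filter_upwards [eventually_le_atBot 0] with x hx
    have := hmono hx
    simp only [travelExt_zero, mul_zero, sub_zero] at this
    simpa using this

lemma travelExt_strictAnti {l : ℝ → ℝ} (hl : IsSpeed l) (hneg : ∀ x ∈ Icc (0 : ℝ) 1, l x < 0) :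
    StrictAnti (travelExt l) := by
  have := (travelExt_strictMono_surjective hl.neg fun x hx => neg_pos_of_neg (hneg x hx)).1
  rw [funext (travelExt_neg l)] at this
  intro x y hxy
  simpa using this hxy

namespace IsSpeed

variable {l : ℝ → ℝ} (hl : IsSpeed l)
include hl

lemma travelExt_bijective : Function.Bijective (travelExt l) := by
  rcases hl.sign with h | h
  · refine ⟨(travelExt_strictAnti hl h).injective, fun s => ?_⟩
    obtain ⟨x, hx⟩ := (travelExt_strictMono_surjective hl.neg
      fun x hx => neg_pos_of_neg (h x hx)).2 (-s)
    rw [travelExt_neg] at hx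
    exact ⟨x, neg_injective hx⟩
  · exact ⟨(travelExt_strictMono_surjective hl h).1.injective,
      (travelExt_strictMono_surjective hl h).2⟩

@[simp] lemma position_travelExt (x : ℝ) : position l (travelExt l x) = x :=
  Function.leftInverse_invFun hl.travelExt_bijective.1 x

@[simp] lemma travelExt_position (s : ℝ) : travelExt l (position l s) = s :=
  Function.rightInverse_invFun hl.travelExt_bijective.2 s

lemma continuous_position : Continuous (position l) := by
  rcases hl.sign with h | h
  · have hm : StrictMono fun x => -travelExt l x := (travelExt_strictAnti hl h).neg
    have hs : Function.Surjective fun x => -travelExt l x :=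
      neg_surjective.comp hl.travelExt_bijective.2
    have hc := (hm.orderIsoOfSurjective _ hs).symm.continuous
    have : position l = fun s => (hm.orderIsoOfSurjective _ hs).symm (-s) := by
      ext s
      rw [OrderIso.eq_symm_apply]
      simp [hl.travelExt_position]
    rw [this]
    exact hc.comp continuous_neg
  · have hm : StrictMono (travelExt l) := (travelExt_strictMono_surjective hl h).1
    have hc := (hm.orderIsoOfSurjective _ hl.travelExt_bijective.2).symm.continuous
    have : position l = (hm.orderIsoOfSurjective _ hl.travelExt_bijective.2).symm := by
      ext s
      rw [OrderIso.eq_symm_apply]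
      simp [hl.travelExt_position]
    rw [this]
    exact hc

lemma hasDerivAt_position (s : ℝ) :
    HasDerivAt (position l) (speedExt l (position l s)) s := by
  have := HasDerivAt.of_local_left_inverse hl.continuous_position.continuousAt
    (hl.hasDerivAt_travelExt (position l s)) (inv_ne_zero (hl.ext_ne_zero _))
    (Eventually.of_forall hl.travelExt_position)
  rwa [inv_inv] at this

/-- A preimage under `travelExt l` is an image under its differentiable inverse, and differentiable
maps of the line send null sets to null sets. With the next lemma, this moves almost-everywhere
statements between position and time. -/
lemma quasiMeasurePreserving_travelExt :
    Measure.QuasiMeasurePreserving (travelExt l) volume volume := by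
  refine ⟨hl.continuous_travelExt.measurable, Measure.AbsolutelyContinuous.mk fun N hN h0 => ?_⟩
  rw [Measure.map_apply hl.continuous_travelExt.measurable hN]
  have : travelExt l ⁻¹' N = position l '' N := by
    ext x
    exact ⟨fun h => ⟨_, h, hl.position_travelExt x⟩,
      by rintro ⟨s, hs, rfl⟩; simpa [hl.travelExt_position] using hs⟩
  rw [this]
  exact addHaar_image_eq_zero_of_differentiableOn_of_addHaar_eq_zero _
    (fun s _ => (hl.hasDerivAt_position s).differentiableAt.differentiableWithinAt) h0

lemma quasiMeasurePreserving_position :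
    Measure.QuasiMeasurePreserving (position l) volume volume := by
  refine ⟨hl.continuous_position.measurable, Measure.AbsolutelyContinuous.mk fun N hN h0 => ?_⟩
  rw [Measure.map_apply hl.continuous_position.measurable hN]
  have : position l ⁻¹' N = travelExt l '' N := by
    ext x
    exact ⟨fun h => ⟨_, h, hl.travelExt_position x⟩,
      by rintro ⟨s, hs, rfl⟩; simpa [hl.position_travelExt] using hs⟩
  rw [this]
  exact addHaar_image_eq_zero_of_differentiableOn_of_addHaar_eq_zero _
    (fun s _ => (hl.hasDerivAt_travelExt s).differentiableAt.differentiableWithinAt) h0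

end IsSpeed

/-! ### Pairing `L²` functions with bounded functions. -/

instance : IsProbabilityMeasure unitMeasure := ⟨by simp⟩

lemma integral_add_const_mul {X : Type*} [MeasurableSpace X] {μ : Measure X} {F F₁ F₂ : X → ℝ}
    (c : ℝ) (h₁ : Integrable F₁ μ) (h₂ : Integrable F₂ μ)
    (h : ∀ᵐ x ∂μ, F x = F₁ x + c * F₂ x) :
    ∫ x, F x ∂μ = (∫ x, F₁ x ∂μ) + c * ∫ x, F₂ x ∂μ := by
  rw [integral_congr_ae h, integral_add h₁ (h₂.const_mul c), integral_const_mul]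

lemma integrable_coeFn (v : Lp ℝ 2 unitMeasure) : Integrable v unitMeasure :=
  (Lp.memLp v).integrable one_le_two

lemma integrable_bounded_mul {m : ℝ → ℝ} (hm : AEStronglyMeasurable m unitMeasure) {C : ℝ}
    (hC : ∀ᵐ x ∂unitMeasure, |m x| ≤ C) (v : Lp ℝ 2 unitMeasure) :
    Integrable (fun x => m x * v x) unitMeasure :=
  (integrable_coeFn v).bdd_mul hm hC

lemma integral_abs_le_norm (v : Lp ℝ 2 unitMeasure) : ∫ x, |v x| ∂unitMeasure ≤ ‖v‖ := by
  have h1 : ∫ x, ‖v x‖ ∂unitMeasure = (eLpNorm v 1 unitMeasure).toReal := by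
    rw [integral_norm_eq_lintegral_enorm (Lp.aestronglyMeasurable v),
      eLpNorm_one_eq_lintegral_enorm]
  have h2 := eLpNorm_le_eLpNorm_of_exponent_le (p := 1) (q := 2) (μ := unitMeasure)
    one_le_two (Lp.aestronglyMeasurable v)
  calc ∫ x, |v x| ∂unitMeasure = (eLpNorm v 1 unitMeasure).toReal := h1
    _ ≤ (eLpNorm v 2 unitMeasure).toReal := ENNReal.toReal_mono (Lp.eLpNorm_ne_top v) h2
    _ = ‖v‖ := (Lp.norm_def v).symm

lemma abs_integral_mul_le {m : ℝ → ℝ} {C : ℝ}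
    (hC : ∀ᵐ x ∂unitMeasure, |m x| ≤ C) (v : Lp ℝ 2 unitMeasure) :
    |∫ x, m x * v x ∂unitMeasure| ≤ C * ‖v‖ := by
  have hC0 : 0 ≤ C := by
    obtain ⟨x, hx⟩ := hC.exists
    exact (abs_nonneg _).trans hx
  calc |∫ x, m x * v x ∂unitMeasure| ≤ ∫ x, C * |v x| ∂unitMeasure := by
        rw [← Real.norm_eq_abs]
        refine norm_integral_le_of_norm_le ((integrable_coeFn v).abs.const_mul C) ?_
        filter_upwards [hC] with x hx
        rw [norm_mul]
        exact mul_le_mul_of_nonneg_right hx (abs_nonneg _)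
    _ = C * ∫ x, |v x| ∂unitMeasure := integral_const_mul _ _
    _ ≤ C * ‖v‖ := mul_le_mul_of_nonneg_left (integral_abs_le_norm v) hC0

/-- Both factors depend on `t`. Splitting `u t = (u t - u t₀) + u t₀`, the first part is small in
norm, and the second is handled by dominated convergence with `u t₀` fixed. -/
lemma continuousOn_integral_mul {D : ℝ × ℝ → ℝ} (hD : Continuous D) {C : ℝ}
    (hC : ∀ q, |D q| ≤ C) {u : ℝ → Lp ℝ 2 unitMeasure} {s : Set ℝ} (hu : ContinuousOn u s) :
    ContinuousOn (fun t => ∫ x, D (t, x) * u t x ∂unitMeasure) s := by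
  intro t₀ ht₀
  have hm : ∀ t, AEStronglyMeasurable (fun x => D (t, x)) unitMeasure := fun t =>
    (hD.comp (Continuous.prodMk_right t)).aestronglyMeasurable
  have key : ∀ t, ∫ x, D (t, x) * u t x ∂unitMeasure =
      (∫ x, D (t, x) * (u t - u t₀ : Lp ℝ 2 unitMeasure) x ∂unitMeasure) +
        ∫ x, D (t, x) * u t₀ x ∂unitMeasure := by
    intro t
    rw [← integral_add (integrable_bounded_mul (hm t) (.of_forall fun x => hC _) _)
      (integrable_bounded_mul (hm t) (.of_forall fun x => hC _) _)]
    refine integral_congr_ae ?_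
    filter_upwards [Lp.coeFn_sub (u t) (u t₀)] with x hx
    rw [hx, Pi.sub_apply]
    ring
  have h2 : Continuous fun t => ∫ x, D (t, x) * u t₀ x ∂unitMeasure := by
    refine continuous_of_dominated (bound := fun x => C * |u t₀ x|) (fun t => ?_) (fun t => ?_)
      ((integrable_coeFn _).abs.const_mul C) (.of_forall fun x => ?_)
    · exact (hm t).mul (Lp.aestronglyMeasurable _)
    · refine .of_forall fun x => ?_
      rw [norm_mul]
      exact mul_le_mul_of_nonneg_right (hC _) (abs_nonneg _)
    · exact (hD.comp (Continuous.prodMk_left x)).mul continuous_const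
  have h1 : Tendsto (fun t => ∫ x, D (t, x) * (u t - u t₀ : Lp ℝ 2 unitMeasure) x ∂unitMeasure)
      (𝓝[s] t₀) (𝓝 0) := by
    refine squeeze_zero_norm (a := fun t => C * ‖u t - u t₀‖) (fun t =>
      abs_integral_mul_le (.of_forall fun x => hC _) _) ?_
    have : Tendsto (fun t => C * ‖u t - u t₀‖) (𝓝[s] t₀) (𝓝 (C * ‖u t₀ - u t₀‖)) :=
      ((hu t₀ ht₀).sub tendsto_const_nhds).norm.const_mul C
    simpa using this
  have h3 := h1.add (h2.continuousAt.continuousWithinAt (s := s) (x := t₀)).tendsto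
  simp only [zero_add] at h3
  exact (h3.congr fun t => (key t).symm)

/-! ### The weak form tested with globally continuous functions. -/

/-- `Θ` and `D` are bounded continuous functions on the plane extending the test function `θ`
and `θ_t + (lθ)_x`. -/
structure IsTestExtension (l : ℝ → ℝ) (τ : ℝ) (θ : ℝ → ℝ → ℝ) (Θ D : ℝ × ℝ → ℝ) : Prop where
  contDiffOn : ContDiffOn ℝ 1 (Function.uncurry θ) (Icc 0 τ ×ˢ Icc 0 1)
  continuous : Continuous Θ
  continuous_div : Continuous D
  bounded : ∃ C, ∀ q, |Θ q| ≤ C ∧ |D q| ≤ C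
  eq : ∀ t ∈ Icc 0 τ, ∀ x ∈ Icc (0 : ℝ) 1, Θ (t, x) = θ t x
  div_eq : ∀ t ∈ Ioo 0 τ, ∀ x ∈ Ioo (0 : ℝ) 1,
    D (t, x) = deriv (fun s => θ s x) t + deriv (fun y => l y * θ t y) x

lemma exists_continuous_extension {τ : ℝ} (hτ : 0 ≤ τ) {F : ℝ × ℝ → ℝ}
    (hF : ContinuousOn F (Icc 0 τ ×ˢ Icc 0 1)) :
    ∃ E : ℝ × ℝ → ℝ, Continuous E ∧ (∃ C, ∀ q, |E q| ≤ C) ∧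
      ∀ q ∈ Icc 0 τ ×ˢ Icc (0 : ℝ) 1, E q = F q := by
  let P : ℝ × ℝ → ℝ × ℝ := fun q => (projIcc 0 τ hτ q.1, projIcc 0 1 zero_le_one q.2)
  have hP : Continuous P :=
    (continuous_subtype_val.comp (continuous_projIcc.comp continuous_fst)).prodMk
      (continuous_subtype_val.comp (continuous_projIcc.comp continuous_snd))
  have hPm : ∀ q, P q ∈ Icc 0 τ ×ˢ Icc (0 : ℝ) 1 := fun q => ⟨Subtype.prop _, Subtype.prop _⟩
  obtain ⟨C, hC⟩ := (isCompact_Icc.prod isCompact_Icc).exists_bound_of_continuousOn hF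
  refine ⟨F ∘ P, hF.comp_continuous hP hPm, ⟨C, fun q => hC _ (hPm q)⟩, fun q hq => ?_⟩
  simp [P, projIcc_of_mem hτ hq.1, projIcc_of_mem zero_le_one hq.2]

lemma hasDerivAt_slices {l : ℝ → ℝ} (hl : ContDiffOn ℝ 1 l (Icc 0 1)) {τ : ℝ}
    {θ : ℝ → ℝ → ℝ} (hθ : ContDiffOn ℝ 1 (Function.uncurry θ) (Icc 0 τ ×ˢ Icc 0 1))
    {t x : ℝ} (ht : t ∈ Ioo 0 τ) (hx : x ∈ Ioo (0 : ℝ) 1) :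
    HasFDerivAt (Function.uncurry θ)
        (fderivWithin ℝ (Function.uncurry θ) (Icc 0 τ ×ˢ Icc 0 1) (t, x)) (t, x) ∧
      HasDerivAt l (derivWithin l (Icc 0 1) x) x := by
  constructor
  · have hn : Icc 0 τ ×ˢ Icc (0 : ℝ) 1 ∈ 𝓝 (t, x) :=
      prod_mem_nhds (Icc_mem_nhds ht.1 ht.2) (Icc_mem_nhds hx.1 hx.2)
    exact ((hθ.differentiableOn one_ne_zero) (t, x) ⟨Ioo_subset_Icc_self ht,
      Ioo_subset_Icc_self hx⟩).hasFDerivWithinAt.hasFDerivAt hn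
  · exact ((hl.differentiableOn one_ne_zero) x
      (Ioo_subset_Icc_self hx)).hasDerivWithinAt.hasDerivAt (Icc_mem_nhds hx.1 hx.2)

/-- The derivatives of `θ` and `l` within the closed sets are continuous up to the boundary and
coincide with the ordinary derivatives in the interior. Boundary points are null for the double
integral, so the values of `deriv` there do not matter. Positivity of `τ` is what makes the closed
rectangle a set of unique differentiability. -/
lemma exists_testExtension {l : ℝ → ℝ} (hl : ContDiffOn ℝ 1 l (Icc 0 1)) {τ : ℝ} (hτ : 0 < τ)
    {θ : ℝ → ℝ → ℝ} (hθ : ContDiffOn ℝ 1 (Function.uncurry θ) (Icc 0 τ ×ˢ Icc 0 1)) :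
    ∃ Θ D, IsTestExtension l τ θ Θ D := by
  obtain ⟨Θ, hΘc, ⟨C₁, hC₁⟩, hΘ⟩ := exists_continuous_extension hτ.le hθ.continuousOn
  set R := Icc 0 τ ×ˢ Icc (0 : ℝ) 1
  have hd : ContinuousOn (fderivWithin ℝ (Function.uncurry θ) R) R :=
    hθ.continuousOn_fderivWithin
      ((uniqueDiffOn_Icc hτ).prod (uniqueDiffOn_Icc zero_lt_one)) le_rfl
  have hl' : ContinuousOn (derivWithin l (Icc 0 1)) (Icc 0 1) :=
    hl.continuousOn_derivWithin (uniqueDiffOn_Icc zero_lt_one) le_rfl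
  have hs : MapsTo (Prod.snd : ℝ × ℝ → ℝ) R (Icc 0 1) := fun q hq => hq.2
  obtain ⟨D, hDc, ⟨C₂, hC₂⟩, hD⟩ := exists_continuous_extension hτ.le
    (F := fun q => fderivWithin ℝ (Function.uncurry θ) R q (1, 0) +
      (derivWithin l (Icc 0 1) q.2 * Function.uncurry θ q +
        l q.2 * fderivWithin ℝ (Function.uncurry θ) R q (0, 1)))
    ((hd.clm_apply continuousOn_const).add
      (((hl'.comp continuousOn_snd hs).mul hθ.continuousOn).add
        ((hl.continuousOn.comp continuousOn_snd hs).mul (hd.clm_apply continuousOn_const))))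
  refine ⟨Θ, D, hθ, hΘc, hDc, ⟨max C₁ C₂, fun q => ⟨(hC₁ q).trans (le_max_left _ _),
    (hC₂ q).trans (le_max_right _ _)⟩⟩, fun t ht x hx => hΘ _ ⟨ht, hx⟩, fun t ht x hx => ?_⟩
  rw [hD (t, x) ⟨Ioo_subset_Icc_self ht, Ioo_subset_Icc_self hx⟩]
  obtain ⟨h1, h2⟩ := hasDerivAt_slices hl hθ ht hx
  have ht' : HasDerivAt (fun s => θ s x)
      (fderivWithin ℝ (Function.uncurry θ) R (t, x) (1, 0)) t :=
    HasFDerivAt.comp_hasDerivAt (f := fun s => (s, x)) t h1 ((hasDerivAt_id t).prodMk (hasDerivAt_const t x))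
  have hx' : HasDerivAt (fun y => θ t y)
      (fderivWithin ℝ (Function.uncurry θ) R (t, x) (0, 1)) x :=
    HasFDerivAt.comp_hasDerivAt (f := fun y => (t, y)) x h1 ((hasDerivAt_const x t).prodMk (hasDerivAt_id x))
  have hm : HasDerivAt (fun y => l y * θ t y) _ x := h2.mul hx'
  rw [ht'.deriv, hm.deriv]
  rfl

namespace IsTestExtension

variable {l : ℝ → ℝ} {τ : ℝ} {θ : ℝ → ℝ → ℝ} {Θ D : ℝ × ℝ → ℝ}

lemma weak_form_iff (h : IsTestExtension l τ θ Θ D) (hτ : 0 < τ) (u : ℝ → Lp ℝ 2 unitMeasure)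
    (a b : ℝ → ℝ) (f : ℝ → ℝ → ℝ) :
    ((∫ x, θ τ x * u τ x ∂unitMeasure) - (∫ x, θ 0 x * u 0 x ∂unitMeasure) =
      (∫ t in (0 : ℝ)..τ, ∫ x,
          (deriv (fun s => θ s x) t + deriv (fun y => l y * θ t y) x) * u t x ∂unitMeasure)
      + (∫ t in (0 : ℝ)..τ, (l 0 * θ t 0 * a t - l 1 * θ t 1 * b t))
      + ∫ t in (0 : ℝ)..τ, ∫ x, θ t x * f t x ∂unitMeasure) ↔
    (∫ x, Θ (τ, x) * u τ x ∂unitMeasure) - (∫ x, Θ (0, x) * u 0 x ∂unitMeasure) =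
      (∫ t in Ioo 0 τ, ∫ x, D (t, x) * u t x ∂unitMeasure)
      + (∫ t in Ioo 0 τ, (l 0 * Θ (t, 0) * a t - l 1 * Θ (t, 1) * b t))
      + ∫ t in Ioo 0 τ, ∫ x, Θ (t, x) * f t x ∂unitMeasure := by
  have e1 : ∀ t ∈ Icc 0 τ, ∀ v : ℝ → ℝ,
      ∫ x, θ t x * v x ∂unitMeasure = ∫ x, Θ (t, x) * v x ∂unitMeasure := fun t ht v =>
    setIntegral_congr_fun measurableSet_Ioo fun x hx => by
      simp only [h.eq t ht x (Ioo_subset_Icc_self hx)]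
  have e2 : ∀ t ∈ Ioo 0 τ, ∫ x, (deriv (fun s => θ s x) t + deriv (fun y => l y * θ t y) x) * u t x
      ∂unitMeasure = ∫ x, D (t, x) * u t x ∂unitMeasure := fun t ht =>
    setIntegral_congr_fun measurableSet_Ioo fun x hx => by simp only [h.div_eq t ht x hx]
  rw [e1 τ ⟨hτ.le, le_rfl⟩, e1 0 ⟨le_rfl, hτ.le⟩]
  simp only [intervalIntegral.integral_of_le hτ.le, integral_Ioc_eq_integral_Ioo]
  have e3 : ∀ t ∈ Ioo 0 τ, l 0 * θ t 0 * a t - l 1 * θ t 1 * b t =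
      l 0 * Θ (t, 0) * a t - l 1 * Θ (t, 1) * b t := fun t ht => by
    rw [h.eq t (Ioo_subset_Icc_self ht) 0 ⟨le_rfl, zero_le_one⟩,
      h.eq t (Ioo_subset_Icc_self ht) 1 ⟨zero_le_one, le_rfl⟩]
  rw [setIntegral_congr_fun measurableSet_Ioo e2, setIntegral_congr_fun measurableSet_Ioo
      (fun t ht => e1 t (Ioo_subset_Icc_self ht) _), setIntegral_congr_fun measurableSet_Ioo e3]

end IsTestExtension

/-- It is enough to check the weak form for bounded continuous extensions of test functions. -/
lemma weakTransport_iff {l : ℝ → ℝ} (hl : ContDiffOn ℝ 1 l (Icc 0 1))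
    {u : ℝ → Lp ℝ 2 unitMeasure} {a b : ℝ → ℝ} {f : ℝ → ℝ → ℝ} :
    WeakTransport l u a b f ↔ ∀ τ, 0 < τ → ∀ θ Θ D, IsTestExtension l τ θ Θ D →
    (∫ x, Θ (τ, x) * u τ x ∂unitMeasure) - (∫ x, Θ (0, x) * u 0 x ∂unitMeasure) =
      (∫ t in Ioo 0 τ, ∫ x, D (t, x) * u t x ∂unitMeasure)
      + (∫ t in Ioo 0 τ, (l 0 * Θ (t, 0) * a t - l 1 * Θ (t, 1) * b t))
      + ∫ t in Ioo 0 τ, ∫ x, Θ (t, x) * f t x ∂unitMeasure := by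
  constructor
  · intro h τ hτ θ Θ D hext
    exact (hext.weak_form_iff hτ u a b f).1 (h τ hτ.le θ hext.contDiffOn)
  · intro h τ hτ θ hθ
    rcases hτ.eq_or_lt with rfl | hτ
    · simp
    · obtain ⟨Θ, D, hext⟩ := exists_testExtension hl hτ hθ
      exact (hext.weak_form_iff hτ u a b f).2 (h τ hτ θ Θ D hext)

/-! ### Linear combinations and modifications of weak solutions. -/

/-- A weak solution of a scalar transport equation with locally integrable data. -/
structure IsTransport (l : ℝ → ℝ) (u : ℝ → Lp ℝ 2 unitMeasure) (a b : ℝ → ℝ) (f : ℝ → ℝ → ℝ) :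
    Prop where
  weak : WeakTransport l u a b f
  continuousOn : ContinuousOn u (Ici 0)
  integrable_left : ∀ T, IntegrableOn a (Ioo 0 T)
  integrable_right : ∀ T, IntegrableOn b (Ioo 0 T)
  integrable_source : ∀ T, Integrable (Function.uncurry f)
    ((volume.restrict (Ioo 0 T)).prod unitMeasure)

namespace IsTransport

variable {l : ℝ → ℝ} {u u' : ℝ → Lp ℝ 2 unitMeasure} {a a' b b' : ℝ → ℝ} {f f' : ℝ → ℝ → ℝ}

lemma add_smul (hl : ContDiffOn ℝ 1 l (Icc 0 1)) (h : IsTransport l u a b f)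
    (h' : IsTransport l u' a' b' f') (c : ℝ) :
    IsTransport l (fun t => u t + c • u' t) (fun t => a t + c * a' t) (fun t => b t + c * b' t)
      (fun t x => f t x + c * f' t x) where
  continuousOn := h.continuousOn.add (h'.continuousOn.const_smul c)
  integrable_left T := (h.integrable_left T).add ((h'.integrable_left T).const_mul c)
  integrable_right T := (h.integrable_right T).add ((h'.integrable_right T).const_mul c)
  integrable_source T := (h.integrable_source T).add ((h'.integrable_source T).const_mul c)
  weak := by
    rw [weakTransport_iff hl]
    intro τ hτ θ Θ D hext
    obtain ⟨C, hC⟩ := hext.bounded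
    have w := (weakTransport_iff hl).1 h.weak τ hτ θ Θ D hext
    have w' := (weakTransport_iff hl).1 h'.weak τ hτ θ Θ D hext
    have split : ∀ (E : ℝ × ℝ → ℝ), Continuous E → (∀ q, |E q| ≤ C) → ∀ t,
        ∫ x, E (t, x) * (u t + c • u' t : Lp ℝ 2 unitMeasure) x ∂unitMeasure =
        (∫ x, E (t, x) * u t x ∂unitMeasure) + c * ∫ x, E (t, x) * u' t x ∂unitMeasure := by
      intro E hE hEC t
      have hm : AEStronglyMeasurable (fun x => E (t, x)) unitMeasure :=
        (hE.comp (Continuous.prodMk_right t)).aestronglyMeasurable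
      refine integral_add_const_mul c (integrable_bounded_mul hm (.of_forall fun x => hEC _) _)
        (integrable_bounded_mul hm (.of_forall fun x => hEC _) _) ?_
      filter_upwards [Lp.coeFn_add (u t) (c • u' t), Lp.coeFn_smul c (u' t)] with x h1 h2
      rw [h1, Pi.add_apply, h2, Pi.smul_apply, smul_eq_mul]
      ring
    have hsub : Icc 0 τ ⊆ Ici 0 := fun t ht => ht.1
    have hI : ∀ v : ℝ → Lp ℝ 2 unitMeasure, ContinuousOn v (Ici 0) →
        IntegrableOn (fun t => ∫ x, D (t, x) * v t x ∂unitMeasure) (Ioo 0 τ) := fun v hv =>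
      ((continuousOn_integral_mul hext.continuous_div (fun q => (hC q).2)
        (hv.mono hsub)).integrableOn_Icc).mono_set Ioo_subset_Icc_self
    have hB : ∀ (x r : ℝ) (v : ℝ → ℝ), IntegrableOn v (Ioo 0 τ) →
        IntegrableOn (fun t => r * Θ (t, x) * v t) (Ioo 0 τ) := fun x r v hv => by
      refine Integrable.bdd_mul (c := |r| * C) hv ?_ (.of_forall fun t => ?_)
      · exact (continuous_const.mul
          (hext.continuous.comp (Continuous.prodMk_left x))).aestronglyMeasurable
      · rw [norm_mul]
        exact mul_le_mul_of_nonneg_left (hC _).1 (abs_nonneg _)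
    have hF : ∀ v : ℝ → ℝ → ℝ, Integrable (Function.uncurry v)
        ((volume.restrict (Ioo 0 τ)).prod unitMeasure) →
        Integrable (fun q : ℝ × ℝ => Θ q * Function.uncurry v q)
        ((volume.restrict (Ioo 0 τ)).prod unitMeasure) := fun v hv =>
      hv.bdd_mul hext.continuous.aestronglyMeasurable (.of_forall fun q => (hC q).1)
    have f1 := hF f (h.integrable_source τ)
    have f2 := hF f' (h'.integrable_source τ)
    have s3 : ∫ t in Ioo 0 τ, ∫ x, Θ (t, x) * (f t x + c * f' t x) ∂unitMeasure =
        (∫ t in Ioo 0 τ, ∫ x, Θ (t, x) * f t x ∂unitMeasure) +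
          c * ∫ t in Ioo 0 τ, ∫ x, Θ (t, x) * f' t x ∂unitMeasure := by
      refine integral_add_const_mul c f1.integral_prod_left f2.integral_prod_left ?_
      filter_upwards [f1.prod_right_ae, f2.prod_right_ae] with t h1 h2
      refine integral_add_const_mul c h1 h2 (.of_forall fun x => ?_)
      ring
    have s2 : ∫ t in Ioo 0 τ, (l 0 * Θ (t, 0) * (a t + c * a' t)
          - l 1 * Θ (t, 1) * (b t + c * b' t)) =
        (∫ t in Ioo 0 τ, (l 0 * Θ (t, 0) * a t - l 1 * Θ (t, 1) * b t)) +
          c * ∫ t in Ioo 0 τ, (l 0 * Θ (t, 0) * a' t - l 1 * Θ (t, 1) * b' t) := by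
      refine integral_add_const_mul c ((hB 0 _ a (h.integrable_left τ)).sub
        (hB 1 _ b (h.integrable_right τ))) ((hB 0 _ a' (h'.integrable_left τ)).sub
        (hB 1 _ b' (h'.integrable_right τ))) (.of_forall fun t => ?_)
      ring
    have s1 : ∫ t in Ioo 0 τ, ∫ x, D (t, x) * (u t + c • u' t : Lp ℝ 2 unitMeasure) x
          ∂unitMeasure =
        (∫ t in Ioo 0 τ, ∫ x, D (t, x) * u t x ∂unitMeasure) +
          c * ∫ t in Ioo 0 τ, ∫ x, D (t, x) * u' t x ∂unitMeasure := by
      exact integral_add_const_mul c (hI u h.continuousOn) (hI u' h'.continuousOn)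
        (.of_forall fun t => split D hext.continuous_div (fun q => (hC q).2) t)
    rw [split Θ hext.continuous (fun q => (hC q).1), split Θ hext.continuous
      (fun q => (hC q).1), s1, s2, s3]
    linear_combination w + c * w'

lemma add_sum_smul (hl : ContDiffOn ℝ 1 l (Icc 0 1)) (h : IsTransport l u a b f) {ι : Type*}
    (s : Finset ι) (c : ι → ℝ) {v : ι → ℝ → Lp ℝ 2 unitMeasure} {α β : ι → ℝ → ℝ}
    {g : ι → ℝ → ℝ → ℝ} (hv : ∀ i ∈ s, IsTransport l (v i) (α i) (β i) (g i)) :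
    IsTransport l (fun t => u t + ∑ i ∈ s, c i • v i t) (fun t => a t + ∑ i ∈ s, c i * α i t)
      (fun t => b t + ∑ i ∈ s, c i * β i t) (fun t x => f t x + ∑ i ∈ s, c i * g i t x) := by
  classical
  induction s using Finset.induction_on with
  | empty => simpa using h
  | insert i s hi ih =>
    have := (ih fun j hj => hv j (Finset.mem_insert_of_mem hj)).add_smul hl
      (hv i (Finset.mem_insert_self i s)) (c i)
    simp only [Finset.sum_insert hi]
    simpa only [add_assoc, add_comm (c i • _), add_comm (c i * _)] using this

end IsTransport

lemma WeakTransport.congr {l : ℝ → ℝ} {u u' : ℝ → Lp ℝ 2 unitMeasure} {a a' b b' : ℝ → ℝ}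
    {f f' : ℝ → ℝ → ℝ} (h : WeakTransport l u a b f) (hu : ∀ t, 0 ≤ t → u t = u' t)
    (ha : ∀ᵐ t ∂volume.restrict (Ioi (0 : ℝ)), a t = a' t)
    (hb : ∀ᵐ t ∂volume.restrict (Ioi (0 : ℝ)), b t = b' t)
    (hf : ∀ᵐ t ∂volume.restrict (Ioi (0 : ℝ)), f t = f' t) : WeakTransport l u' a' b' f' := by
  intro τ hτ θ hθ
  have h0 := h τ hτ θ hθ
  rw [hu τ hτ, hu 0 le_rfl] at h0
  rw [h0]
  have hae : ∀ {p : ℝ → Prop}, (∀ᵐ t ∂volume.restrict (Ioi (0 : ℝ)), p t) →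
      ∀ᵐ t ∂volume, t ∈ uIoc 0 τ → p t := fun {p} hp => by
    rw [ae_restrict_iff' measurableSet_Ioi] at hp
    filter_upwards [hp] with t ht hmem
    rw [uIoc_of_le hτ] at hmem
    exact ht hmem.1
  congr 1
  · congr 1
    · refine intervalIntegral.integral_congr fun t ht => ?_
      rw [uIcc_of_le hτ] at ht
      simp only [hu t ht.1]
    · refine intervalIntegral.integral_congr_ae ?_
      filter_upwards [hae ha, hae hb] with t h1 h2 hmem
      rw [h1 hmem, h2 hmem]
  · refine intervalIntegral.integral_congr_ae ?_
    filter_upwards [hae hf] with t h1 hmem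
    rw [h1 hmem]

/-! ### Homogeneous transport along characteristics. -/

/-- The times at which the characteristics through the points `(τ, x)`, `0 < x < 1`, cross
`x = 0`. -/
def crossingTimes (l : ℝ → ℝ) (τ : ℝ) : Set ℝ := {s | position l (τ - s) ∈ Ioo (0 : ℝ) 1}

namespace IsSpeed

variable {l : ℝ → ℝ} (hl : IsSpeed l)
include hl

lemma mem_crossingTimes_iff (τ x : ℝ) :
    τ - travelExt l x ∈ crossingTimes l τ ↔ x ∈ Ioo (0 : ℝ) 1 := by
  simp [crossingTimes, hl.position_travelExt]

lemma measurableSet_crossingTimes (τ : ℝ) : MeasurableSet (crossingTimes l τ) :=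
  (hl.continuous_position.comp (continuous_const.sub continuous_id)).measurable measurableSet_Ioo

lemma image_eq_crossingTimes (τ : ℝ) :
    (fun x => τ - travelExt l x) '' Ioo 0 1 = crossingTimes l τ := by
  ext s
  constructor
  · rintro ⟨x, hx, rfl⟩
    exact (hl.mem_crossingTimes_iff τ x).2 hx
  · intro hs
    exact ⟨_, hs, by simp [hl.travelExt_position]⟩

lemma injective_sub_travelExt (τ : ℝ) : Function.Injective fun x => τ - travelExt l x :=
  sub_right_injective.comp hl.travelExt_bijective.1

lemma hasDerivAt_sub_travelExt (τ x : ℝ) :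
    HasDerivAt (fun x => τ - travelExt l x) (-(speedExt l x)⁻¹) x :=
  (hl.hasDerivAt_travelExt x).const_sub τ

/-- This is the change of variables `s = τ - φ(x)`, whose Jacobian is `|1 / l|`. -/
lemma setIntegral_crossingTimes (τ : ℝ) (F : ℝ → ℝ) :
    ∫ s in crossingTimes l τ, F s = ∫ x, |(l x)⁻¹| * F (τ - travelExt l x) ∂unitMeasure := by
  rw [← hl.image_eq_crossingTimes, integral_image_eq_integral_abs_deriv_smul measurableSet_Ioo
    (fun x _ => (hl.hasDerivAt_sub_travelExt τ x).hasDerivWithinAt)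
    (hl.injective_sub_travelExt τ).injOn]
  refine setIntegral_congr_fun measurableSet_Ioo fun x hx => ?_
  simp only [abs_neg, smul_eq_mul, speedExt_of_mem l (Ioo_subset_Icc_self hx)]

lemma exists_bound_inv : ∃ C, ∀ x, |(speedExt l x)⁻¹| ≤ C := by
  have : ContinuousOn (fun x => (l x)⁻¹) (Icc 0 1) :=
    hl.continuousOn.inv₀ fun x hx => hl.ne_zero hx
  obtain ⟨C, -, hC⟩ := exists_bound_speedExt this
  exact ⟨C, hC⟩

lemma integrableOn_crossingTimes (τ : ℝ) {v : ℝ → ℝ} (hv : Integrable v unitMeasure) :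
    IntegrableOn (fun s => v (position l (τ - s))) (crossingTimes l τ) := by
  rw [← hl.image_eq_crossingTimes, integrableOn_image_iff_integrableOn_abs_deriv_smul
    measurableSet_Ioo (fun x _ => (hl.hasDerivAt_sub_travelExt τ x).hasDerivWithinAt)
    (hl.injective_sub_travelExt τ).injOn]
  simp only [sub_sub_cancel, hl.position_travelExt, smul_eq_mul, abs_neg]
  obtain ⟨C, hC⟩ := hl.exists_bound_inv
  refine Integrable.bdd_mul (c := C) hv ?_ (.of_forall fun x => ?_)
  · exact (hl.continuous_ext.inv₀ hl.ext_ne_zero).abs.aestronglyMeasurable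
  · simpa using hC x

lemma ae_unit_of_ae_crossingTimes (τ : ℝ) {p : ℝ → Prop} (h : ∀ᵐ s, s ∈ crossingTimes l τ → p s) :
    ∀ᵐ x ∂unitMeasure, p (τ - travelExt l x) := by
  rw [ae_restrict_iff' measurableSet_Ioo]
  have h1 : ∀ᵐ s, τ - s ∈ crossingTimes l τ → p (τ - s) :=
    (Measure.measurePreserving_sub_left volume τ).quasiMeasurePreserving.ae h
  filter_upwards [hl.quasiMeasurePreserving_travelExt.ae h1] with x hx hmem
  exact hx ((hl.mem_crossingTimes_iff τ x).2 hmem)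

lemma ae_crossingTimes_of_ae_unit (τ : ℝ) {p : ℝ → Prop} (h : ∀ᵐ x ∂unitMeasure, p x) :
    ∀ᵐ s, s ∈ crossingTimes l τ → p (position l (τ - s)) := by
  rw [ae_restrict_iff' measurableSet_Ioo] at h
  exact (Measure.measurePreserving_sub_left volume τ).quasiMeasurePreserving.ae
    (hl.quasiMeasurePreserving_position.ae h)

end IsSpeed

lemma IsSpeed.contDiffOn_inv {l : ℝ → ℝ} (hl : IsSpeed l) (hc : ContDiffOn ℝ 1 l (Icc 0 1)) :
    ContDiffOn ℝ 1 (fun x => (l x)⁻¹) (Icc 0 1) :=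
  hc.inv fun _ hx => hl.ne_zero hx

/-- Testing a homogeneous transport equation against functions that are constant along
characteristics. -/
lemma WeakTransport.characteristic_integral {l : ℝ → ℝ} (hc : ContDiffOn ℝ 1 l (Icc 0 1))
    (hl : IsSpeed l) {u : ℝ → Lp ℝ 2 unitMeasure} {a b : ℝ → ℝ}
    (h : WeakTransport l u a b fun _ _ => 0) {ψ : ℝ → ℝ} (hψ : ContDiff ℝ 1 ψ) {τ : ℝ}
    (hτ : 0 ≤ τ) :
    (∫ x, (l x)⁻¹ * (ψ (τ - travelExt l x) * u τ x) ∂unitMeasure) -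
      (∫ x, (l x)⁻¹ * (ψ (0 - travelExt l x) * u 0 x) ∂unitMeasure) =
      ∫ t in Ioo 0 τ, (ψ t * a t - ψ (t - travelExt l 1) * b t) := by
  -- For `θ = ψ(t - φ(x)) / l(x)` the product `lθ` is constant along characteristics, so `θ_t +
  -- (lθ)_x = 0` and only initial, final and boundary terms survive.
  have hθ : ContDiffOn ℝ 1 (Function.uncurry fun t x => (l x)⁻¹ * ψ (t - travelExt l x))
      (Icc 0 τ ×ˢ Icc 0 1) :=
    ((hl.contDiffOn_inv hc).comp contDiff_snd.contDiffOn fun q hq => hq.2).mul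
      (hψ.comp (contDiff_fst.sub (hl.contDiff_travelExt.comp contDiff_snd))).contDiffOn
  have h0 := h τ hτ _ hθ
  have hdiv : ∀ t, ∀ x ∈ Ioo (0 : ℝ) 1, deriv (fun s => (l x)⁻¹ * ψ (s - travelExt l x)) t +
      deriv (fun y => l y * ((l y)⁻¹ * ψ (t - travelExt l y))) x = 0 := by
    intro t x hx
    have hψ' : ∀ s, HasDerivAt ψ (deriv ψ s) s := fun s =>
      (hψ.differentiable one_ne_zero s).hasDerivAt
    have h1 : HasDerivAt (fun s => (l x)⁻¹ * ψ (s - travelExt l x)) _ t :=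
      (((hψ' _).comp t ((hasDerivAt_id t).sub_const (travelExt l x))).const_mul (l x)⁻¹)
    have h2 : HasDerivAt (fun y => ψ (t - travelExt l y)) _ x :=
      (hψ' _).comp x (hl.hasDerivAt_sub_travelExt t x)
    have h3 : (fun y => l y * ((l y)⁻¹ * ψ (t - travelExt l y))) =ᶠ[𝓝 x]
        fun y => ψ (t - travelExt l y) := by
      filter_upwards [Ioo_mem_nhds hx.1 hx.2] with y hy
      rw [mul_inv_cancel_left₀ (hl.ne_zero (Ioo_subset_Icc_self hy))]
    rw [h1.deriv, h3.deriv_eq, h2.deriv, speedExt_of_mem l (Ioo_subset_Icc_self hx)]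
    simp only [id]
    ring
  have hz : ∀ t, ∫ x, (deriv (fun s => (l x)⁻¹ * ψ (s - travelExt l x)) t +
      deriv (fun y => l y * ((l y)⁻¹ * ψ (t - travelExt l y))) x) * u t x ∂unitMeasure = 0 :=
    fun t => by
      rw [setIntegral_congr_fun (g := fun _ => (0 : ℝ)) measurableSet_Ioo fun x hx => by
        simp only [hdiv t x hx, zero_mul]]
      simp
  simp only [hz, mul_zero, integral_zero, zero_add, add_zero,
    travelExt_zero, sub_zero, mul_inv_cancel_left₀ (hl.ne_zero ⟨le_rfl, zero_le_one⟩),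
    mul_inv_cancel_left₀ (hl.ne_zero ⟨zero_le_one, le_rfl⟩), mul_assoc,
    intervalIntegral.integral_of_le hτ, integral_Ioc_eq_integral_Ioo] at h0
  simpa only [mul_assoc] using h0

/-- The solution of a homogeneous transport equation along characteristics: the values that leave
the domain `(0,τ) × (0,1)` are those that enter it. -/
lemma WeakTransport.ae_characteristic {l : ℝ → ℝ} (hc : ContDiffOn ℝ 1 l (Icc 0 1))
    (hl : IsSpeed l) {ε : ℝ} (hε : ∀ x ∈ Icc (0 : ℝ) 1, |(l x)⁻¹| = ε * (l x)⁻¹)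
    {u : ℝ → Lp ℝ 2 unitMeasure} {a b : ℝ → ℝ}
    (h : WeakTransport l u a b fun _ _ => 0) {τ : ℝ} (hτ : 0 ≤ τ)
    (ha : IntegrableOn a (Ioo 0 τ)) (hb : IntegrableOn b (Ioo 0 τ)) :
    ∀ᵐ s, (crossingTimes l τ).indicator (fun s => u τ (position l (τ - s))) s -
        (crossingTimes l 0).indicator (fun s => u 0 (position l (0 - s))) s -
        ε * ((Ioo 0 τ).indicator a s - (Ioo 0 τ).indicator b (s + travelExt l 1)) = 0 := by
  have i1 : ∀ σ, Integrable ((crossingTimes l σ).indicator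
      (fun s => u σ (position l (σ - s)))) := fun σ =>
    (integrable_indicator_iff (hl.measurableSet_crossingTimes σ)).2
      (hl.integrableOn_crossingTimes σ (integrable_coeFn _))
  have i2 : Integrable ((Ioo 0 τ).indicator a) :=
    (integrable_indicator_iff measurableSet_Ioo).2 ha
  have i3 : Integrable (fun s => (Ioo 0 τ).indicator b (s + travelExt l 1)) :=
    ((integrable_indicator_iff measurableSet_Ioo).2 hb).comp_add_right _
  -- Since `ψ` is arbitrary, it suffices to check the identity in the sense of distributions in the
  -- crossing time `s`; the three kinds of terms are then converted to the `s` variable. The sign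
  -- `ε` of the speed accounts for the absolute value in the Jacobian.
  refine ae_eq_zero_of_integral_contDiff_smul_eq_zero
    (((i1 τ).sub (i1 0)).sub ((i2.sub i3).const_mul ε)).locallyIntegrable fun ψ hψ hcs => ?_
  obtain ⟨C, hC⟩ := hψ.continuous.bounded_above_of_compact_support hcs
  have hm : ∀ {g : ℝ → ℝ}, Integrable g → Integrable fun s => ψ s * g s := fun hg =>
    hg.bdd_mul hψ.continuous.aestronglyMeasurable (.of_forall hC)
  have h0 := h.characteristic_integral hc hl (ψ := ψ) (hψ.of_le (by exact_mod_cast le_top)) hτ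
  have j1 : ∀ σ, ∫ s, ψ s * (crossingTimes l σ).indicator
      (fun s => u σ (position l (σ - s))) s =
      ε * ∫ x, (l x)⁻¹ * (ψ (σ - travelExt l x) * u σ x) ∂unitMeasure := by
    intro σ
    rw [← integral_const_mul]
    simp only [← indicator_mul_right (crossingTimes l σ) ψ]
    rw [integral_indicator (hl.measurableSet_crossingTimes σ), hl.setIntegral_crossingTimes]
    refine setIntegral_congr_fun measurableSet_Ioo fun x hx => ?_
    simp only [hε x (Ioo_subset_Icc_self hx), sub_sub_cancel, hl.position_travelExt]
    ring
  have j2 : ∫ s, ψ s * (Ioo 0 τ).indicator a s = ∫ t in Ioo 0 τ, ψ t * a t := by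
    simp only [← indicator_mul_right (Ioo 0 τ) ψ]
    rw [integral_indicator measurableSet_Ioo]
  have j3 : ∫ s, ψ s * (Ioo 0 τ).indicator b (s + travelExt l 1) =
      ∫ t in Ioo 0 τ, ψ (t - travelExt l 1) * b t := by
    rw [← integral_indicator measurableSet_Ioo,
      ← integral_add_right_eq_self (fun t => (Ioo 0 τ).indicator
        (fun t => ψ (t - travelExt l 1) * b t) t) (travelExt l 1)]
    congr 1
    ext s
    rw [indicator_mul_right (Ioo 0 τ) (fun t => ψ (t - travelExt l 1)), add_sub_cancel_right]
  have k2 : IntegrableOn (fun t => ψ t * a t) (Ioo 0 τ) :=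
    Integrable.bdd_mul ha hψ.continuous.aestronglyMeasurable (.of_forall hC)
  have k3 : IntegrableOn (fun t => ψ (t - travelExt l 1) * b t) (Ioo 0 τ) :=
    Integrable.bdd_mul hb (hψ.continuous.comp
      (continuous_id.sub continuous_const)).aestronglyMeasurable (.of_forall fun t => hC _)
  rw [integral_sub k2 k3] at h0
  rw [integral_add_const_mul (-ε) ((hm (i1 τ)).sub (hm (i1 0))) ((hm i2).sub (hm i3))
    (.of_forall fun s => by simp only [Pi.sub_apply, smul_eq_mul]; ring),
    integral_sub' (hm (i1 τ)) (hm (i1 0)), integral_sub' (hm i2) (hm i3), j1, j1, j2, j3]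
  linear_combination ε * h0

/-- The initial datum `v`, as a function of the time at which its values leave at `x = 0`, for a
negative speed. -/
def exitProfile (l : ℝ → ℝ) (v : ℝ → ℝ) : ℝ → ℝ :=
  (crossingTimes l 0).indicator fun s => v (position l (0 - s))

section Negative

variable {l : ℝ → ℝ} (hl : IsSpeed l) (hneg : ∀ x ∈ Icc (0 : ℝ) 1, l x < 0)
include hl hneg

lemma lt_of_mem_crossingTimes {τ s : ℝ} (hs : s ∈ crossingTimes l τ) :
    τ < s ∧ s < τ - travelExt l 1 := by
  have h1 := travelExt_strictAnti hl hneg hs.1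
  have h2 := travelExt_strictAnti hl hneg hs.2
  rw [hl.travelExt_position] at h1 h2
  rw [travelExt_zero] at h1
  constructor <;> linarith

variable (hc : ContDiffOn ℝ 1 l (Icc 0 1)) {u : ℝ → Lp ℝ 2 unitMeasure} {a b : ℝ → ℝ}
  (h : WeakTransport l u a b fun _ _ => 0) (ha : ∀ T, IntegrableOn a (Ioo 0 T))
  (hb0 : ∀ᵐ t ∂volume.restrict (Ioi (0 : ℝ)), b t = 0)
include hc h ha hb0

lemma WeakTransport.ae_exit {τ : ℝ} (hτ : 0 ≤ τ) :
    ∀ᵐ s, (crossingTimes l τ).indicator (fun s => u τ (position l (τ - s))) s -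
        exitProfile l (u 0) s + (Ioo 0 τ).indicator a s = 0 := by
  have h' : WeakTransport l u a (fun _ => 0) fun _ _ => 0 :=
    h.congr (fun _ _ => rfl) (.of_forall fun _ => rfl) hb0 (.of_forall fun _ => rfl)
  filter_upwards [h'.ae_characteristic hc hl (ε := -1) (fun x hx => by
    rw [abs_of_neg (inv_lt_zero.2 (hneg x hx))]; ring) hτ (ha τ) (by simp)] with s hs
  simp only [indicator_zero, sub_zero] at hs
  rw [exitProfile]
  linear_combination hs

/-- What is still inside at time `τ` leaves after `τ`, so the trace on `(0,τ)` does not contribute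
at its crossing time, and with zero inflow only the initial datum remains. -/
lemma WeakTransport.eq_exitProfile {τ : ℝ} (hτ : 0 ≤ τ) :
    ∀ᵐ x ∂unitMeasure, u τ x = exitProfile l (u 0) (τ - travelExt l x) := by
  have := hl.ae_unit_of_ae_crossingTimes τ
    (p := fun s => u τ (position l (τ - s)) = exitProfile l (u 0) s) (by
      filter_upwards [h.ae_exit hl hneg hc ha hb0 hτ] with s hs hmem
      rw [indicator_of_mem hmem, indicator_of_notMem fun hm : s ∈ Ioo 0 τ =>
        (lt_of_mem_crossingTimes hl hneg hmem).1.not_gt hm.2] at hs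
      linarith)
  simpa only [sub_sub_cancel, hl.position_travelExt] using this

/-- Take the balance at an integer time `n > t`: nothing that exits at time `t` is still inside.
Integer times keep the exceptional set a countable union of null sets. -/
lemma WeakTransport.left_trace_eq_exitProfile :
    ∀ᵐ t ∂volume.restrict (Ioi (0 : ℝ)), a t = exitProfile l (u 0) t := by
  rw [ae_restrict_iff' measurableSet_Ioi]
  have := ae_all_iff.2 fun n : ℕ => h.ae_exit hl hneg hc ha hb0 (τ := n) (Nat.cast_nonneg n)
  filter_upwards [this] with t ht hpos
  obtain ⟨n, hn⟩ := exists_nat_gt t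
  have hs := ht n
  rw [indicator_of_notMem (s := crossingTimes l n) fun hm =>
    (lt_of_mem_crossingTimes hl hneg hm).1.not_gt hn,
    indicator_of_mem (show t ∈ Ioo (0 : ℝ) n from ⟨hpos, hn⟩)] at hs
  linarith

lemma WeakTransport.eq_zero_of_neg (h0 : u 0 = 0) :
    (∀ t, 0 ≤ t → u t = 0) ∧ ∀ᵐ t ∂volume.restrict (Ioi (0 : ℝ)), a t = 0 := by
  have hz : ∀ᵐ s, exitProfile l (u 0) s = 0 := by
    have h1 : ∀ᵐ x ∂unitMeasure, u 0 x = 0 := by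
      rw [h0]
      exact Lp.coeFn_zero ℝ 2 unitMeasure
    filter_upwards [hl.ae_crossingTimes_of_ae_unit 0 h1] with s hs
    rw [exitProfile, indicator_apply_eq_zero]
    exact hs
  constructor
  · intro t ht
    rw [Lp.eq_zero_iff_ae_eq_zero]
    filter_upwards [h.eq_exitProfile hl hneg hc ha hb0 ht,
      hl.ae_unit_of_ae_crossingTimes t (p := fun s => exitProfile l (u 0) s = 0)
        (hz.mono fun s hs _ => hs)] with x h1 h2
    rw [h1, h2, Pi.zero_apply]
  · filter_upwards [h.left_trace_eq_exitProfile hl hneg hc ha hb0,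
      ae_restrict_of_ae hz] with t h1 h2
    rw [h1, h2]

end Negative

lemma WeakTransport.eq_zero_of_pos {l : ℝ → ℝ} (hl : IsSpeed l)
    (hpos : ∀ x ∈ Icc (0 : ℝ) 1, 0 < l x) (hc : ContDiffOn ℝ 1 l (Icc 0 1))
    {u : ℝ → Lp ℝ 2 unitMeasure} {a b : ℝ → ℝ} (h : WeakTransport l u a b fun _ _ => 0)
    (hb : ∀ T, IntegrableOn b (Ioo 0 T))
    (ha0 : ∀ᵐ t ∂volume.restrict (Ioi (0 : ℝ)), a t = 0) (h0 : u 0 = 0)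
    {t : ℝ} (ht : 0 ≤ t) : u t = 0 := by
  have h' : WeakTransport l u (fun _ => 0) b fun _ _ => 0 :=
    h.congr (fun _ _ => rfl) ha0 (.of_forall fun _ => rfl) (.of_forall fun _ => rfl)
  have h1 : ∀ᵐ x ∂unitMeasure, u 0 x = 0 := by
    rw [h0]
    exact Lp.coeFn_zero ℝ 2 unitMeasure
  rw [Lp.eq_zero_iff_ae_eq_zero]
  have := hl.ae_unit_of_ae_crossingTimes t (p := fun s => u t (position l (t - s)) = 0) (by
    filter_upwards [h'.ae_characteristic hc hl (ε := 1) (fun x hx => by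
      rw [abs_of_pos (inv_pos.2 (hpos x hx)), one_mul]) ht (by simp) (hb t),
      hl.ae_crossingTimes_of_ae_unit 0 h1] with s hs h2 hmem
    rw [indicator_of_mem hmem, indicator_apply_eq_zero.2 h2,
      indicator_of_notMem (a := s + travelExt l 1)] at hs
    · simpa using hs
    -- For a positive speed, a value inside at time `t` reaches `x = 1` only at `s + φ(1) > t`, so
    -- the outflow trace on `(0,t)` drops out.
    · have h3 := (travelExt_strictMono_surjective hl hpos).1 hmem.2
      rw [hl.travelExt_position] at h3
      exact fun hm => by linarith [hm.2])
  filter_upwards [this] with x hx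
  simpa only [sub_sub_cancel, Pi.zero_apply, hl.position_travelExt] using hx

/-! ### Green's formula for superpositions of waves. -/

/-- Green's formula on `(0,τ) × (ξ,1)` for a smooth solution `α(t + c - φ(x))`. -/
lemma green_travelling_wave {l : ℝ → ℝ} (hc : ContDiffOn ℝ 1 l (Icc 0 1)) (hl : IsSpeed l)
    {τ : ℝ} (hτ : 0 < τ) {θ : ℝ → ℝ → ℝ} {Θ D : ℝ × ℝ → ℝ} (hext : IsTestExtension l τ θ Θ D)
    {α : ℝ → ℝ} (hα : ContDiff ℝ 1 α) (c : ℝ) {ξ : ℝ} (hξ : ξ ∈ Icc (0 : ℝ) 1) :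
    (∫ x in Ioo ξ 1, Θ (τ, x) * α (τ + c - travelExt l x)) -
      (∫ x in Ioo ξ 1, Θ (0, x) * α (0 + c - travelExt l x)) =
    (∫ t in Ioo 0 τ, ∫ x in Ioo ξ 1, D (t, x) * α (t + c - travelExt l x)) +
      ((∫ t in Ioo 0 τ, l ξ * Θ (t, ξ) * α (t + c - travelExt l ξ)) -
        ∫ t in Ioo 0 τ, l 1 * Θ (t, 1) * α (t + c - travelExt l 1)) := by
  set v : ℝ × ℝ → ℝ := fun q => α (q.1 + c - travelExt l q.2) with hv
  have hv1 : ContDiff ℝ 1 v :=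
    hα.comp ((contDiff_fst.add contDiff_const).sub (hl.contDiff_travelExt.comp contDiff_snd))
  set f : ℝ × ℝ → ℝ := fun q => Θ q * v q with hf
  set g : ℝ × ℝ → ℝ := fun q => speedExt l q.2 * Θ q * v q with hg
  have hfc : Continuous f := hext.continuous.mul hv1.continuous
  have hgc : Continuous g :=
    ((hl.continuous_ext.comp continuous_snd).mul hext.continuous).mul hv1.continuous
  -- The wave `v` satisfies `v_t + l v_x = 0`, so the divergence of `(Θv, lΘv)` is `(θ_t + (lθ)_x)
  -- v`. It is computed only in the open rectangle, where `Θ` has derivatives.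
  have key : ∀ q ∈ Ioo 0 τ ×ˢ Ioo ξ 1, DifferentiableAt ℝ f q ∧ DifferentiableAt ℝ g q ∧
      fderiv ℝ f q (1, 0) + fderiv ℝ g q (0, 1) = D q * v q := by
    rintro ⟨t, x⟩ ⟨ht, hx'⟩
    have hx : x ∈ Ioo (0 : ℝ) 1 := ⟨hξ.1.trans_lt hx'.1, hx'.2⟩
    obtain ⟨h1, h2⟩ := hasDerivAt_slices hc hext.contDiffOn ht hx
    have hΘe : Θ =ᶠ[𝓝 (t, x)] Function.uncurry θ := by
      filter_upwards [prod_mem_nhds (Icc_mem_nhds ht.1 ht.2) (Icc_mem_nhds hx.1 hx.2)] with q hq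
      exact hext.eq q.1 hq.1 q.2 hq.2
    have hle : speedExt l =ᶠ[𝓝 x] l := by
      filter_upwards [Icc_mem_nhds hx.1 hx.2] with y hy
      exact speedExt_of_mem l hy
    have dΘ : DifferentiableAt ℝ Θ (t, x) := (h1.congr_of_eventuallyEq hΘe).differentiableAt
    have dl : DifferentiableAt ℝ (speedExt l) x :=
      (h2.congr_of_eventuallyEq hle).differentiableAt
    have dl' : DifferentiableAt ℝ (fun q : ℝ × ℝ => speedExt l q.2) (t, x) :=
      DifferentiableAt.comp (g := speedExt l) (f := Prod.snd) (t, x) dl differentiableAt_snd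
    have dv : DifferentiableAt ℝ v (t, x) := hv1.differentiable one_ne_zero _
    have df : DifferentiableAt ℝ f (t, x) := dΘ.mul dv
    have dg : DifferentiableAt ℝ g (t, x) := (dl'.mul dΘ).mul dv
    refine ⟨df, dg, ?_⟩
    have sf : HasDerivAt (fun s => f (s, x)) (fderiv ℝ f (t, x) (1, 0)) t :=
      HasFDerivAt.comp_hasDerivAt (f := fun s => (s, x)) t df.hasFDerivAt
        ((hasDerivAt_id t).prodMk (hasDerivAt_const t x))
    have sg : HasDerivAt (fun y => g (t, y)) (fderiv ℝ g (t, x) (0, 1)) x :=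
      HasFDerivAt.comp_hasDerivAt (f := fun y => (t, y)) x dg.hasFDerivAt
        ((hasDerivAt_const x t).prodMk (hasDerivAt_id x))
    have dθt : DifferentiableAt ℝ (fun s => θ s x) t :=
      DifferentiableAt.comp (g := Function.uncurry θ) (f := fun s => (s, x)) t
        h1.differentiableAt (by fun_prop)
    have dθx : DifferentiableAt ℝ (fun y => θ t y) x :=
      DifferentiableAt.comp (g := Function.uncurry θ) (f := fun y => (t, y)) x
        h1.differentiableAt (by fun_prop)
    have dα : ∀ s, HasDerivAt α (deriv α s) s := fun s =>
      (hα.differentiable one_ne_zero s).hasDerivAt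
    have vt : HasDerivAt (fun s => v (s, x)) (deriv α (t + c - travelExt l x) * 1) t :=
      HasDerivAt.comp (h := fun s => s + c - travelExt l x) t (dα _)
        (((hasDerivAt_id t).add_const c).sub_const _)
    have vx : HasDerivAt (fun y => v (t, y))
        (deriv α (t + c - travelExt l x) * -(speedExt l x)⁻¹) x :=
      HasDerivAt.comp (h := fun y => t + c - travelExt l y) x (dα _)
        (hl.hasDerivAt_sub_travelExt (t + c) x)
    have sf' : HasDerivAt (fun s => f (s, x)) _ t :=
      (dθt.hasDerivAt.mul vt).congr_of_eventuallyEq (by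
        filter_upwards [Icc_mem_nhds ht.1 ht.2] with s hs
        simp only [hf, Pi.mul_apply, hext.eq s hs x (Ioo_subset_Icc_self hx)])
    have dlθ : HasDerivAt (fun y => l y * θ t y) _ x :=
      (h2.differentiableAt.mul dθx).hasDerivAt
    have sg' : HasDerivAt (fun y => g (t, y)) _ x :=
      (dlθ.mul vx).congr_of_eventuallyEq (by
        filter_upwards [Icc_mem_nhds hx.1 hx.2] with y hy
        simp only [hg, Pi.mul_apply, hext.eq t (Ioo_subset_Icc_self ht) y hy,
          speedExt_of_mem l hy])
    rw [sf.unique sf', sg.unique sg', hext.div_eq t ht x hx,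
      speedExt_of_mem l (Ioo_subset_Icc_self hx)]
    have hne := hl.ne_zero (Ioo_subset_Icc_self hx)
    have : deriv (l * fun y => θ t y) x = deriv (fun y => l y * θ t y) x := rfl
    rw [this]
    field_simp
    ring
  have hrect : (Icc 0 τ ×ˢ Icc ξ 1 : Set (ℝ × ℝ)) =ᵐ[volume] Ioo 0 τ ×ˢ Ioo ξ 1 :=
    (Measure.set_prod_ae_eq Ioo_ae_eq_Icc Ioo_ae_eq_Icc).symm
  have hDv : Continuous fun q => D q * v q := hext.continuous_div.mul hv1.continuous
  have hi : IntegrableOn (fun q => fderiv ℝ f q (1, 0) + fderiv ℝ g q (0, 1))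
      (Icc 0 τ ×ˢ Icc ξ 1) := by
    rw [integrableOn_congr_set_ae hrect, integrableOn_congr_fun
      (fun q hq => (key q hq).2.2) (measurableSet_Ioo.prod measurableSet_Ioo)]
    exact (hDv.continuousOn.integrableOn_compact (isCompact_Icc.prod isCompact_Icc)).mono_set
      (prod_mono Ioo_subset_Icc_self Ioo_subset_Icc_self)
  have hopen : Ioo (min 0 τ) (max 0 τ) ×ˢ Ioo (min ξ 1) (max ξ 1) ⊆ Ioo 0 τ ×ˢ Ioo ξ 1 := by
    rw [min_eq_left hτ.le, max_eq_right hτ.le, min_eq_left hξ.2, max_eq_right hξ.2]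
  have main := integral2_divergence_prod_of_hasFDerivAt f g (fderiv ℝ f) (fderiv ℝ g) 0 ξ τ 1
    hfc.continuousOn hgc.continuousOn
    (fun q hq => (key q (hopen hq)).1.hasFDerivAt) (fun q hq => (key q (hopen hq)).2.1.hasFDerivAt)
    (by rwa [uIcc_of_le hτ.le, uIcc_of_le hξ.2])
  simp only [intervalIntegral.integral_of_le hτ.le, intervalIntegral.integral_of_le hξ.2,
    integral_Ioc_eq_integral_Ioo] at main
  have e : ∫ t in Ioo 0 τ, ∫ x in Ioo ξ 1, (fderiv ℝ f (t, x) (1, 0) + fderiv ℝ g (t, x) (0, 1)) =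
      ∫ t in Ioo 0 τ, ∫ x in Ioo ξ 1, D (t, x) * α (t + c - travelExt l x) :=
    setIntegral_congr_fun measurableSet_Ioo fun t ht =>
      setIntegral_congr_fun measurableSet_Ioo fun x hx => (key (t, x) ⟨ht, hx⟩).2.2
  rw [e] at main
  simp only [hf, hg, hv, speedExt_of_mem l hξ, speedExt_of_mem l
    (show (1 : ℝ) ∈ Icc (0 : ℝ) 1 from ⟨zero_le_one, le_rfl⟩)] at main
  linear_combination -main

/-- The wave `α` that starts at `ξ`, on the interval downstream of `ξ`. -/
def delayedWave (l α : ℝ → ℝ) (ξ t x : ℝ) : ℝ :=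
  if ξ < x then α (t + travelExt l ξ - travelExt l x) else 0

/-- The superposition `∫₀ˣ h(ξ) α(t + φ(ξ) - φ(x)) dξ`. -/
def duhamel (l h α : ℝ → ℝ) (t x : ℝ) : ℝ :=
  ∫ ξ, h ξ * delayedWave l α ξ t x ∂unitMeasure

lemma integral_mul_delayedWave (l α : ℝ → ℝ) (m : ℝ → ℝ) (t : ℝ) {ξ : ℝ} (hξ : ξ ∈ Icc (0 : ℝ) 1) :
    ∫ x, m x * delayedWave l α ξ t x ∂unitMeasure =
      ∫ x in Ioo ξ 1, m x * α (t + travelExt l ξ - travelExt l x) := by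
  have : ∀ x, m x * delayedWave l α ξ t x =
      (Ioi ξ).indicator (fun x => m x * α (t + travelExt l ξ - travelExt l x)) x := by
    intro x
    by_cases hx : ξ < x
    · simp [delayedWave, hx]
    · simp [delayedWave, hx]
  simp only [this]
  rw [integral_indicator measurableSet_Ioi, Measure.restrict_restrict measurableSet_Ioi]
  congr 2
  ext x
  exact ⟨fun h => ⟨h.1, h.2.2⟩, fun h => ⟨h.1, hξ.1.trans_lt h.1, h.2⟩⟩

lemma IsSpeed.measurable_delayedWave {l : ℝ → ℝ} (hl : IsSpeed l) {α : ℝ → ℝ}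
    (hα : Measurable α) :
    Measurable fun p : ℝ × ℝ × ℝ => delayedWave l α p.1 p.2.1 p.2.2 := by
  have hφ := hl.continuous_travelExt.measurable
  refine Measurable.ite (measurableSet_lt (by fun_prop) (by fun_prop)) ?_ measurable_const
  exact hα.comp ((measurable_snd.fst.add (hφ.comp measurable_fst)).sub
    (hφ.comp measurable_snd.snd))

lemma abs_delayedWave_le {α : ℝ → ℝ} (l : ℝ → ℝ) {A : ℝ} (hA : ∀ s, |α s| ≤ A) (ξ t x : ℝ) :
    |delayedWave l α ξ t x| ≤ A := by
  unfold delayedWave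
  split_ifs
  · exact hA _
  · simpa using (abs_nonneg _).trans (hA 0)

lemma integral_mul_integral_swap {X Y : Type*} [MeasurableSpace X] [MeasurableSpace Y]
    {μ : Measure X} {ν : Measure Y} [IsFiniteMeasure μ] [IsFiniteMeasure ν] {h : X → ℝ}
    {M : X → Y → ℝ} (hh : Measurable h) (hM : Measurable (Function.uncurry M)) {C C' : ℝ}
    (hC : ∀ x, |h x| ≤ C) (hC' : ∀ x y, |M x y| ≤ C') :
    ∫ x, h x * ∫ y, M x y ∂ν ∂μ = ∫ y, ∫ x, h x * M x y ∂μ ∂ν := by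
  simp only [← integral_const_mul]
  refine integral_integral_swap ?_
  refine Integrable.of_bound (C := C * C') ?_ (.of_forall fun q => ?_)
  · exact ((hh.comp measurable_fst).mul hM).aestronglyMeasurable
  · simp only [Function.uncurry, norm_mul]
    exact mul_le_mul (hC _) (hC' _ _) (abs_nonneg _) ((abs_nonneg _).trans (hC q.1))

lemma integrable_mul_integral {X Y : Type*} [MeasurableSpace X] [MeasurableSpace Y]
    {μ : Measure X} {ν : Measure Y} [IsFiniteMeasure μ] [IsFiniteMeasure ν] {h : X → ℝ}
    {M : X → Y → ℝ} (hh : Measurable h) (hM : Measurable (Function.uncurry M)) {C C' : ℝ}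
    (hC : ∀ x, |h x| ≤ C) (hC' : ∀ x y, |M x y| ≤ C') :
    Integrable (fun x => h x * ∫ y, M x y ∂ν) μ := by
  have : Integrable (fun q : X × Y => h q.1 * M q.1 q.2) (μ.prod ν) := by
    refine Integrable.of_bound (C := C * C') ?_ (.of_forall fun q => ?_)
    · exact ((hh.comp measurable_fst).mul hM).aestronglyMeasurable
    · rw [norm_mul]
      exact mul_le_mul (hC _) (hC' _ _) (abs_nonneg _) ((abs_nonneg _).trans (hC q.1))
  simpa only [integral_const_mul] using this.integral_prod_left

lemma tendsto_integral_mul_of_uniform {X : Type*} [MeasurableSpace X] {μ : Measure X}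
    [IsFiniteMeasure μ] {m w : X → ℝ} {W : ℕ → X → ℝ} (hm : AEStronglyMeasurable m μ)
    (hw : AEStronglyMeasurable w μ) (hW : ∀ n, AEStronglyMeasurable (W n) μ) {C B : ℝ}
    (hC : ∀ x, |m x| ≤ C) (hB : ∀ x, |w x| ≤ B) {δ : ℕ → ℝ} (hδ : Tendsto δ atTop (𝓝 0))
    (hWw : ∀ n x, |W n x - w x| ≤ δ n) :
    Tendsto (fun n => ∫ x, m x * W n x ∂μ) atTop (𝓝 (∫ x, m x * w x ∂μ)) := by
  have iw : Integrable (fun x => m x * w x) μ :=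
    (Integrable.of_bound hw B (.of_forall hB)).bdd_mul hm (.of_forall hC)
  have id : ∀ n, Integrable (fun x => W n x - w x) μ := fun n =>
    Integrable.of_bound ((hW n).sub hw) (δ n) (.of_forall (hWw n))
  have key : ∀ n, ∫ x, m x * W n x ∂μ =
      (∫ x, m x * w x ∂μ) + ∫ x, m x * (W n x - w x) ∂μ := fun n => by
    rw [← integral_add iw ((id n).bdd_mul hm (.of_forall hC))]
    congr 1
    ext x
    ring
  simp only [key]
  have : Tendsto (fun n => ∫ x, m x * (W n x - w x) ∂μ) atTop (𝓝 0) := by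
    refine squeeze_zero_norm (a := fun n => C * δ n * μ.real univ) (fun n => ?_)
      (by simpa using (hδ.const_mul C).mul_const (μ.real univ))
    refine norm_integral_le_of_norm_le_const (.of_forall fun x => ?_)
    rw [norm_mul]
    exact mul_le_mul (hC x) (hWw n x) (abs_nonneg _) ((abs_nonneg _).trans (hC x))
  simpa using this.const_add (∫ x, m x * w x ∂μ)

namespace IsSpeed

variable {l : ℝ → ℝ} (hl : IsSpeed l)
include hl

lemma integrable_comp_travelExt {α : ℝ → ℝ} (hα : Integrable α) (c : ℝ) :
    Integrable (fun x => α (c - travelExt l x)) unitMeasure := by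
  have := hα.integrableOn (s := crossingTimes l c)
  rw [← hl.image_eq_crossingTimes, integrableOn_image_iff_integrableOn_abs_deriv_smul
    measurableSet_Ioo (fun x _ => (hl.hasDerivAt_sub_travelExt c x).hasDerivWithinAt)
    (hl.injective_sub_travelExt c).injOn] at this
  obtain ⟨L, -, hL⟩ := exists_bound_speedExt hl.continuousOn
  have h2 := Integrable.bdd_mul (f := fun x => |speedExt l x|) (c := L) this
    hl.continuous_ext.abs.aestronglyMeasurable (.of_forall fun x => by simpa using hL x)
  refine h2.congr (.of_forall fun x => ?_)
  simp only [abs_neg, smul_eq_mul, ← mul_assoc, ← abs_mul, mul_inv_cancel₀ (hl.ext_ne_zero x),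
    abs_one, one_mul]

/-- Substituting `s = c - φ(x)` costs the Jacobian `|l| ≤ L`, and the range of `s` is enlarged to
`ℝ`. The bound does not depend on `c`. -/
lemma integral_abs_comp_travelExt_le {L : ℝ} (hL : ∀ x, |speedExt l x| ≤ L) {α : ℝ → ℝ}
    (hα : Integrable α) (c : ℝ) :
    ∫ x, |α (c - travelExt l x)| ∂unitMeasure ≤ L * ∫ s, |α s| := by
  have hL0 : 0 ≤ L := (abs_nonneg _).trans (hL 0)
  have h1 : ∫ s in crossingTimes l c, |α s| ≤ ∫ s, |α s| :=
    setIntegral_le_integral hα.abs (.of_forall fun _ => abs_nonneg _)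
  refine le_trans ?_ (mul_le_mul_of_nonneg_left h1 hL0)
  rw [hl.setIntegral_crossingTimes, ← integral_const_mul]
  have hi := (hl.integrable_comp_travelExt hα c).abs
  obtain ⟨C, hC⟩ := hl.exists_bound_inv
  have hi' : Integrable (fun x => L * (|(speedExt l x)⁻¹| * |α (c - travelExt l x)|))
      unitMeasure := by
    refine Integrable.const_mul (hi.bdd_mul (c := C) ?_ (.of_forall fun x => ?_)) L
    · exact (hl.continuous_ext.inv₀ hl.ext_ne_zero).abs.aestronglyMeasurable
    · simpa using hC x
  calc _ ≤ ∫ x, L * (|(speedExt l x)⁻¹| * |α (c - travelExt l x)|) ∂unitMeasure := by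
        refine integral_mono hi hi' fun x => ?_
        have : 1 ≤ L * |(speedExt l x)⁻¹| := by
          rw [abs_inv, ← div_eq_mul_inv, one_le_div (abs_pos.2 (hl.ext_ne_zero x))]
          exact hL x
        rw [← mul_assoc]
        exact le_mul_of_one_le_left (abs_nonneg _) this
    _ = _ := setIntegral_congr_fun measurableSet_Ioo fun x hx => by
        simp only [speedExt_of_mem l (Ioo_subset_Icc_self hx)]

lemma integrable_comp_travelExt_add {α : ℝ → ℝ} (hα : Integrable α) (c : ℝ) :
    Integrable (fun x => α (c + travelExt l x)) unitMeasure := by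
  have := hl.integrable_comp_travelExt hα.comp_neg (-c)
  refine this.congr (.of_forall fun x => ?_)
  simp only
  congr 1
  ring

lemma integral_abs_comp_travelExt_add_le {L : ℝ} (hL : ∀ x, |speedExt l x| ≤ L) {α : ℝ → ℝ}
    (hα : Integrable α) (c : ℝ) :
    ∫ x, |α (c + travelExt l x)| ∂unitMeasure ≤ L * ∫ s, |α s| := by
  have := hl.integral_abs_comp_travelExt_le hL hα.comp_neg (-c)
  rw [integral_neg_eq_self (fun s => |α s|) volume] at this
  refine le_trans (le_of_eq ?_) this
  congr 1
  ext x
  congr 2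
  ring

variable {h : ℝ → ℝ} (hh : Measurable h) {C : ℝ} (hC : ∀ x, |h x| ≤ C)
include hh

lemma stronglyMeasurable_duhamel {α : ℝ → ℝ} (hα : Measurable α) :
    StronglyMeasurable fun q : ℝ × ℝ => duhamel l h α q.1 q.2 := by
  refine StronglyMeasurable.integral_prod_right
    (f := fun (q : ℝ × ℝ) ξ => h ξ * delayedWave l α ξ q.1 q.2) ?_
  exact ((hh.comp measurable_snd).mul ((hl.measurable_delayedWave hα).comp
    (measurable_snd.prodMk measurable_fst))).stronglyMeasurable

include hC

lemma integrable_mul_delayedWave {α : ℝ → ℝ} (hα : Measurable α) (hαi : Integrable α) (t x : ℝ) :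
    Integrable (fun ξ => h ξ * delayedWave l α ξ t x) unitMeasure := by
  refine Integrable.bdd_mul (c := C) ?_ hh.aestronglyMeasurable (.of_forall hC)
  have hi := hl.integrable_comp_travelExt_add hαi (t - travelExt l x)
  refine hi.mono ?_ (.of_forall fun ξ => ?_)
  · exact ((hl.measurable_delayedWave hα).comp
      (measurable_id.prodMk (measurable_const (a := ((t, x) : ℝ × ℝ))))).aestronglyMeasurable
  · unfold delayedWave
    split_ifs
    · rw [show t + travelExt l ξ - travelExt l x = t - travelExt l x + travelExt l ξ by ring]
    · simp

/-- Integrating over starting points makes the superposition depend on `α` only through its `L¹`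
norm, uniformly in `(t,x)`. This includes the boundary line `x = 1`, and it is what lets Green's
formula pass from smooth to integrable waves. -/
lemma abs_duhamel_sub_le {L : ℝ} (hL : ∀ x, |speedExt l x| ≤ L) {α β : ℝ → ℝ}
    (hα : Measurable α) (hαi : Integrable α) (hβ : Measurable β) (hβi : Integrable β) (t x : ℝ) :
    |duhamel l h α t x - duhamel l h β t x| ≤ C * (L * ∫ s, |α s - β s|) := by
  have hC0 : 0 ≤ C := (abs_nonneg _).trans (hC 0)
  unfold duhamel
  rw [← integral_sub (hl.integrable_mul_delayedWave hh hC hα hαi t x)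
    (hl.integrable_mul_delayedWave hh hC hβ hβi t x)]
  have hi := hl.integrable_comp_travelExt_add (hαi.sub hβi) (t - travelExt l x)
  refine le_trans ?_ (mul_le_mul_of_nonneg_left (hl.integral_abs_comp_travelExt_add_le hL
    (hαi.sub hβi) (t - travelExt l x)) hC0)
  rw [← integral_const_mul, ← Real.norm_eq_abs]
  refine norm_integral_le_of_norm_le (hi.abs.const_mul C) (.of_forall fun ξ => ?_)
  rw [← mul_sub, norm_mul]
  refine mul_le_mul (hC ξ) ?_ (norm_nonneg _) hC0
  unfold delayedWave
  split_ifs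
  · rw [show t + travelExt l ξ - travelExt l x = t - travelExt l x + travelExt l ξ by ring]
    rfl
  · simp

lemma abs_duhamel_le {L : ℝ} (hL : ∀ x, |speedExt l x| ≤ L) {α : ℝ → ℝ}
    (hα : Measurable α) (hαi : Integrable α) (t x : ℝ) :
    |duhamel l h α t x| ≤ C * (L * ∫ s, |α s|) := by
  have := hl.abs_duhamel_sub_le hh hC hL hα hαi (β := fun _ => 0) measurable_const
    (integrable_zero _ _ _) t x
  simpa [duhamel, delayedWave] using this

/-- Green's formula for a superposition of smooth waves. -/
lemma green_duhamel_smooth (hc : ContDiffOn ℝ 1 l (Icc 0 1)) {τ : ℝ} (hτ : 0 < τ)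
    {θ : ℝ → ℝ → ℝ} {Θ D : ℝ × ℝ → ℝ} (hext : IsTestExtension l τ θ Θ D) {α : ℝ → ℝ}
    (hα : ContDiff ℝ 1 α) {A : ℝ} (hA : ∀ s, |α s| ≤ A) :
    (∫ x, Θ (τ, x) * duhamel l h α τ x ∂unitMeasure) -
      (∫ x, Θ (0, x) * duhamel l h α 0 x ∂unitMeasure) =
    (∫ q, D q * duhamel l h α q.1 q.2 ∂((volume.restrict (Ioo 0 τ)).prod unitMeasure)) +
      ((∫ t in Ioo 0 τ, (∫ ξ, h ξ * (speedExt l ξ * Θ (t, ξ)) ∂unitMeasure) * α t) -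
        ∫ t in Ioo 0 τ, l 1 * Θ (t, 1) * duhamel l h α t 1) := by
  obtain ⟨B, hB⟩ := hext.bounded
  obtain ⟨L, -, hL⟩ := exists_bound_speedExt hl.continuousOn
  have hA0 : 0 ≤ A := (abs_nonneg _).trans (hA 0)
  have hB0 : 0 ≤ B := (abs_nonneg _).trans (hB (0, 0)).1
  have hJ := hl.measurable_delayedWave hα.continuous.measurable
  have hΘ := hext.continuous.measurable
  have hD := hext.continuous_div.measurable
  have hlm := hl.continuous_ext.measurable
  have hαm := hα.continuous.measurable
  have m1 : ∀ σ, Measurable (Function.uncurry fun ξ x => Θ (σ, x) * delayedWave l α ξ σ x) :=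
    fun σ => (hΘ.comp (measurable_const.prodMk measurable_snd)).mul
      (hJ.comp (measurable_fst.prodMk (measurable_const.prodMk measurable_snd)))
  have m3 : Measurable (Function.uncurry fun ξ (q : ℝ × ℝ) =>
      D q * delayedWave l α ξ q.1 q.2) := (hD.comp measurable_snd).mul hJ
  have m4 : Measurable (Function.uncurry fun ξ t => speedExt l ξ * Θ (t, ξ) * α t) :=
    ((hlm.comp measurable_fst).mul (hΘ.comp (measurable_snd.prodMk measurable_fst))).mul
      (hαm.comp measurable_snd)
  have m5 : Measurable (Function.uncurry fun ξ t => l 1 * Θ (t, 1) * delayedWave l α ξ t 1) :=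
    (measurable_const.mul (hΘ.comp (measurable_snd.prodMk measurable_const))).mul
      (hJ.comp (measurable_fst.prodMk (measurable_snd.prodMk measurable_const)))
  have b1 : ∀ σ ξ x, |Θ (σ, x) * delayedWave l α ξ σ x| ≤ B * A := fun σ ξ x => by
    rw [abs_mul]
    exact mul_le_mul (hB _).1 (abs_delayedWave_le l hA _ _ _) (abs_nonneg _) hB0
  have b3 : ∀ ξ (q : ℝ × ℝ), |D q * delayedWave l α ξ q.1 q.2| ≤ B * A := fun ξ q => by
    rw [abs_mul]
    exact mul_le_mul (hB _).2 (abs_delayedWave_le l hA _ _ _) (abs_nonneg _) hB0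
  have b4 : ∀ ξ t, |speedExt l ξ * Θ (t, ξ) * α t| ≤ L * B * A := fun ξ t => by
    rw [abs_mul, abs_mul]
    have := (abs_nonneg _).trans (hL 0)
    gcongr
    · exact hL ξ
    · exact (hB _).1
    · exact hA t
  have b5 : ∀ ξ t, |l 1 * Θ (t, 1) * delayedWave l α ξ t 1| ≤ |l 1| * B * A := fun ξ t => by
    rw [abs_mul, abs_mul]
    gcongr
    · exact (hB _).1
    · exact abs_delayedWave_le l hA _ _ _
  -- The shift `φ(ξ)` normalises the wave started at `ξ` to equal `α(t)` at `x = ξ`. The boundary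
  -- term there becomes the source term once multiplied by `h ξ` and integrated over `ξ`.
  have green : ∀ ξ ∈ Ioo (0 : ℝ) 1,
      h ξ * (∫ x, Θ (τ, x) * delayedWave l α ξ τ x ∂unitMeasure) -
        h ξ * (∫ x, Θ (0, x) * delayedWave l α ξ 0 x ∂unitMeasure) =
      h ξ * (∫ q, D q * delayedWave l α ξ q.1 q.2
          ∂((volume.restrict (Ioo 0 τ)).prod unitMeasure)) +
        (h ξ * (∫ t in Ioo 0 τ, speedExt l ξ * Θ (t, ξ) * α t) -
          h ξ * ∫ t in Ioo 0 τ, l 1 * Θ (t, 1) * delayedWave l α ξ t 1) := by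
    intro ξ hξ
    have hξ' := Ioo_subset_Icc_self hξ
    have hi : Integrable (fun q : ℝ × ℝ => D q * delayedWave l α ξ q.1 q.2)
        ((volume.restrict (Ioo 0 τ)).prod unitMeasure) :=
      Integrable.of_bound (m3.comp (measurable_const (a := ξ).prodMk
        measurable_id)).aestronglyMeasurable (B * A) (.of_forall fun q => b3 ξ q)
    rw [integral_prod _ hi, integral_mul_delayedWave _ _ _ _ hξ',
      integral_mul_delayedWave _ _ _ _ hξ']
    simp only [integral_mul_delayedWave l α _ _ hξ']
    have g0 := green_travelling_wave hc hl hτ hext hα (travelExt l ξ) hξ'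
    simp only [add_sub_cancel_right] at g0
    simp only [delayedWave, hξ.2, if_true, speedExt_of_mem l hξ']
    linear_combination h ξ * g0
  have i1 := fun σ => integrable_mul_integral (μ := unitMeasure) (ν := unitMeasure) hh (m1 σ) hC
    (b1 σ)
  have i3 := integrable_mul_integral (μ := unitMeasure)
    (ν := (volume.restrict (Ioo 0 τ)).prod unitMeasure) hh m3 hC b3
  have i4 := integrable_mul_integral (μ := unitMeasure) (ν := volume.restrict (Ioo 0 τ)) hh m4 hC b4
  have i5 := integrable_mul_integral (μ := unitMeasure) (ν := volume.restrict (Ioo 0 τ)) hh m5 hC b5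
  have i45 := i4.sub i5
  simp only [Pi.sub_def] at i45
  have total := setIntegral_congr_fun (μ := volume) measurableSet_Ioo green
  rw [integral_sub (i1 τ) (i1 0), integral_add i3 i45, integral_sub i4 i5,
    integral_mul_integral_swap hh (m1 τ) hC (b1 τ), integral_mul_integral_swap hh (m1 0) hC (b1 0),
    integral_mul_integral_swap hh m3 hC b3, integral_mul_integral_swap hh m4 hC b4,
    integral_mul_integral_swap hh m5 hC b5] at total
  simp only [mul_left_comm (h _) (_ * _) (delayedWave l α _ _ _),
    mul_left_comm (h _) _ (delayedWave l α _ _ _)] at total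
  simp only [integral_const_mul] at total
  simp only [← mul_assoc (h _) _ (α _), integral_mul_const] at total
  exact total

/-- Green's formula for a superposition of integrable waves. -/
lemma green_duhamel (hc : ContDiffOn ℝ 1 l (Icc 0 1)) {τ : ℝ} (hτ : 0 < τ)
    {θ : ℝ → ℝ → ℝ} {Θ D : ℝ × ℝ → ℝ} (hext : IsTestExtension l τ θ Θ D) {α : ℝ → ℝ}
    (hα : Measurable α) (hαi : Integrable α) :
    (∫ x, Θ (τ, x) * duhamel l h α τ x ∂unitMeasure) -
      (∫ x, Θ (0, x) * duhamel l h α 0 x ∂unitMeasure) =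
    (∫ q, D q * duhamel l h α q.1 q.2 ∂((volume.restrict (Ioo 0 τ)).prod unitMeasure)) +
      ((∫ t in Ioo 0 τ, (∫ ξ, h ξ * (speedExt l ξ * Θ (t, ξ)) ∂unitMeasure) * α t) -
        ∫ t in Ioo 0 τ, l 1 * Θ (t, 1) * duhamel l h α t 1) := by
  obtain ⟨B, hB⟩ := hext.bounded
  obtain ⟨L, hL0, hL⟩ := exists_bound_speedExt hl.continuousOn
  have hB0 : 0 ≤ B := (abs_nonneg _).trans (hB (0, 0)).1
  have hC0 : 0 ≤ C := (abs_nonneg _).trans (hC 0)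
  -- Approximation of `α` in `L¹` by compactly supported smooth functions; their superpositions then
  -- converge uniformly.
  have happ : ∀ n : ℕ, ∃ g : ℝ → ℝ, HasCompactSupport g ∧ ContDiff ℝ 1 g ∧
      ∫ s, |g s - α s| ≤ 1 / ((n : ℝ) + 1) := by
    intro n
    obtain ⟨g, hg1, hg2, hg3⟩ := (memLp_one_iff_integrable.2 hαi).exist_eLpNorm_sub_le
      ENNReal.one_ne_top le_rfl (ε := 1 / ((n : ℝ) + 1)) (by positivity)
    refine ⟨g, hg1, hg2.of_le (by exact_mod_cast le_top), ?_⟩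
    have hgi : Integrable g := hg2.continuous.integrable_of_hasCompactSupport hg1
    rw [eLpNorm_one_eq_lintegral_enorm] at hg3
    have := integral_norm_eq_lintegral_enorm (hαi.sub hgi).aestronglyMeasurable
    calc ∫ s, |g s - α s| = ∫ s, ‖(α - g) s‖ := by
          simp only [Pi.sub_apply, Real.norm_eq_abs, abs_sub_comm]
      _ ≤ _ := by
          rw [this]
          exact ENNReal.toReal_le_of_le_ofReal (by positivity) hg3
  choose g hg1 hg2 hg3 using happ
  have hgi : ∀ n, Integrable (g n) := fun n =>
    (hg2 n).continuous.integrable_of_hasCompactSupport (hg1 n)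
  have hgm : ∀ n, Measurable (g n) := fun n => (hg2 n).continuous.measurable
  have hδ : Tendsto (fun n => ∫ s, |g n s - α s|) atTop (𝓝 0) :=
    squeeze_zero (fun n => integral_nonneg fun _ => abs_nonneg _) hg3
      tendsto_one_div_add_atTop_nhds_zero_nat
  have hδ' : Tendsto (fun n => C * (L * ∫ s, |g n s - α s|)) atTop (𝓝 0) := by
    simpa using (hδ.const_mul L).const_mul C
  have close : ∀ n t x, |duhamel l h (g n) t x - duhamel l h α t x| ≤
      C * (L * ∫ s, |g n s - α s|) := fun n t x =>
    hl.abs_duhamel_sub_le hh hC hL (hgm n) (hgi n) hα hαi t x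
  have bound := hl.abs_duhamel_le hh hC hL hα hαi
  have sm := fun {β : ℝ → ℝ} (hβ : Measurable β) => hl.stronglyMeasurable_duhamel hh hβ
  have t1 : ∀ σ, Tendsto (fun n => ∫ x, Θ (σ, x) * duhamel l h (g n) σ x ∂unitMeasure) atTop
      (𝓝 (∫ x, Θ (σ, x) * duhamel l h α σ x ∂unitMeasure)) := fun σ =>
    tendsto_integral_mul_of_uniform
      (hext.continuous.comp (Continuous.prodMk_right σ)).aestronglyMeasurable
      ((sm hα).comp_measurable measurable_prodMk_left).aestronglyMeasurable
      (fun n => ((sm (hgm n)).comp_measurable measurable_prodMk_left).aestronglyMeasurable)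
      (fun x => (hB _).1) (fun x => bound σ x) hδ' fun n x => close n σ x
  have t3 : Tendsto (fun n => ∫ q, D q * duhamel l h (g n) q.1 q.2
      ∂((volume.restrict (Ioo 0 τ)).prod unitMeasure)) atTop (𝓝 (∫ q, D q * duhamel l h α q.1 q.2
      ∂((volume.restrict (Ioo 0 τ)).prod unitMeasure))) :=
    tendsto_integral_mul_of_uniform hext.continuous_div.aestronglyMeasurable
      (sm hα).aestronglyMeasurable (fun n => (sm (hgm n)).aestronglyMeasurable)
      (fun q => (hB q).2) (fun q => bound q.1 q.2) hδ' fun n q => close n q.1 q.2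
  have t5 : Tendsto (fun n => ∫ t in Ioo 0 τ, l 1 * Θ (t, 1) * duhamel l h (g n) t 1) atTop
      (𝓝 (∫ t in Ioo 0 τ, l 1 * Θ (t, 1) * duhamel l h α t 1)) :=
    tendsto_integral_mul_of_uniform (C := |l 1| * B)
      (continuous_const.mul
        (hext.continuous.comp (Continuous.prodMk_left 1))).aestronglyMeasurable
      ((sm hα).comp_measurable measurable_prodMk_right).aestronglyMeasurable
      (fun n => ((sm (hgm n)).comp_measurable measurable_prodMk_right).aestronglyMeasurable)
      (fun t => by rw [abs_mul]; exact mul_le_mul_of_nonneg_left (hB _).1 (abs_nonneg _))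
      (fun t => bound t 1) hδ' fun n t => close n t 1
  set κ : ℝ → ℝ := fun t => ∫ ξ, h ξ * (speedExt l ξ * Θ (t, ξ)) ∂unitMeasure with hκ
  have hκm : StronglyMeasurable κ := by
    refine StronglyMeasurable.integral_prod_right
      (f := fun (t : ℝ) ξ => h ξ * (speedExt l ξ * Θ (t, ξ))) ?_
    exact ((hh.comp measurable_snd).mul ((hl.continuous_ext.measurable.comp measurable_snd).mul
      hext.continuous.measurable)).stronglyMeasurable
  have hκb : ∀ t, |κ t| ≤ C * (L * B) := fun t => by
    have := norm_integral_le_of_norm_le_const (μ := unitMeasure) (C := C * (L * B))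
      (f := fun ξ => h ξ * (speedExt l ξ * Θ (t, ξ))) (.of_forall fun ξ => by
        rw [norm_mul, norm_mul]
        exact mul_le_mul (hC ξ) (mul_le_mul (hL ξ) (hB _).1 (abs_nonneg _) hL0.le)
          (by positivity) hC0)
    simpa using this
  -- Here the approximating wave itself appears, with only `L¹` convergence; boundedness of the
  -- weight `κ` suffices.
  have t4 : Tendsto (fun n => ∫ t in Ioo 0 τ, κ t * g n t) atTop
      (𝓝 (∫ t in Ioo 0 τ, κ t * α t)) := by
    have hi : ∀ {β : ℝ → ℝ}, Integrable β → IntegrableOn (fun t => κ t * β t) (Ioo 0 τ) :=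
      fun hβ => (hβ.bdd_mul hκm.aestronglyMeasurable (.of_forall hκb)).integrableOn
    rw [tendsto_iff_norm_sub_tendsto_zero]
    refine squeeze_zero (fun _ => norm_nonneg _)
      (g := fun n => C * (L * B) * ∫ s, |g n s - α s|) (fun n => ?_)
      (by simpa using hδ.const_mul (C * (L * B)))
    rw [← integral_sub (hi (hgi n)) (hi hαi), ← integral_const_mul]
    have hd : Integrable fun t => C * (L * B) * |g n t - α t| := ((hgi n).sub hαi).abs.const_mul _
    refine (norm_integral_le_of_norm_le hd.integrableOn (.of_forall fun t => ?_)).trans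
      (setIntegral_le_integral hd (.of_forall fun t => by positivity))
    rw [← mul_sub, norm_mul]
    exact mul_le_mul_of_nonneg_right (hκb t) (abs_nonneg _)
  refine tendsto_nhds_unique ((t1 τ).sub (t1 0)) ((t3.add (t4.sub t5)).congr fun n => ?_)
  obtain ⟨A, hA⟩ := (hg2 n).continuous.bounded_above_of_compact_support (hg1 n)
  exact (hl.green_duhamel_smooth hh hC hc hτ hext (hg2 n) hA).symm

end IsSpeed

/-! ### Integral operators and the cascade kernel. -/

lemma exists_integralOperator {k : ℝ → ℝ → ℝ} (hk : Measurable (Function.uncurry k)) {C : ℝ}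
    (hC : ∀ x y, |k x y| ≤ C) :
    ∃ T : Lp ℝ 2 unitMeasure →L[ℝ] Lp ℝ 2 unitMeasure,
      ∀ z, T z =ᵐ[unitMeasure] fun x => ∫ y, k x y * z y ∂unitMeasure := by
  have hint : ∀ (z : Lp ℝ 2 unitMeasure) x, Integrable (fun y => k x y * z y) unitMeasure :=
    fun z x => integrable_bounded_mul (hk.comp measurable_prodMk_left).aestronglyMeasurable
      (.of_forall (hC x)) z
  have hb : ∀ (z : Lp ℝ 2 unitMeasure) x, |∫ y, k x y * z y ∂unitMeasure| ≤ C * ‖z‖ :=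
    fun z x => abs_integral_mul_le (.of_forall (hC x)) z
  have hm : ∀ z : Lp ℝ 2 unitMeasure,
      MemLp (fun x => ∫ y, k x y * z y ∂unitMeasure) 2 unitMeasure := fun z => by
    refine MemLp.of_bound ?_ (C * ‖z‖) (.of_forall (hb z))
    refine (StronglyMeasurable.integral_prod_right (f := fun x y => k x y * z y)
      ?_).aestronglyMeasurable
    exact hk.stronglyMeasurable.mul
      ((Lp.stronglyMeasurable z).comp_measurable measurable_snd)
  let T₀ : Lp ℝ 2 unitMeasure →ₗ[ℝ] Lp ℝ 2 unitMeasure :=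
    { toFun := fun z => (hm z).toLp
      map_add' := fun z w => by
        rw [← MemLp.toLp_add]
        refine MemLp.toLp_congr _ _ (.of_forall fun x => ?_)
        simp only [Pi.add_apply]
        rw [← integral_add (hint z x) (hint w x)]
        refine integral_congr_ae ?_
        filter_upwards [Lp.coeFn_add z w] with y hy
        rw [hy, Pi.add_apply, mul_add]
      map_smul' := fun c z => by
        rw [RingHom.id_apply, ← MemLp.toLp_const_smul]
        refine MemLp.toLp_congr _ _ (.of_forall fun x => ?_)
        simp only [Pi.smul_apply, smul_eq_mul]
        rw [← integral_const_mul]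
        refine integral_congr_ae ?_
        filter_upwards [Lp.coeFn_smul c z] with y hy
        rw [hy, Pi.smul_apply, smul_eq_mul, mul_left_comm] }
  refine ⟨T₀.mkContinuous C fun z => ?_, fun z => (hm z).coeFn_toLp⟩
  have hC0 : 0 ≤ C := (abs_nonneg _).trans (hC 0 0)
  have := Lp.norm_le_of_ae_bound (f := T₀ z) (C := C * ‖z‖) (by positivity) (by
    filter_upwards [(hm z).coeFn_toLp] with x hx
    change ‖((hm z).toLp : Lp ℝ 2 unitMeasure) x‖ ≤ _
    rw [hx]
    exact hb z x)
  refine this.trans_eq ?_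
  have h1 : measureUnivNNReal unitMeasure = 1 := by simp [measureUnivNNReal]
  rw [h1]
  simp

lemma exists_integralFunctional {κ : ℝ → ℝ} (hκ : AEStronglyMeasurable κ unitMeasure) {C : ℝ}
    (hC : ∀ᵐ y ∂unitMeasure, |κ y| ≤ C) :
    ∃ R : Lp ℝ 2 unitMeasure →L[ℝ] ℝ, ∀ z, R z = ∫ y, κ y * z y ∂unitMeasure := by
  let R₀ : Lp ℝ 2 unitMeasure →ₗ[ℝ] ℝ :=
    { toFun := fun z => ∫ y, κ y * z y ∂unitMeasure
      map_add' := fun z w => by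
        rw [← integral_add (integrable_bounded_mul hκ hC z) (integrable_bounded_mul hκ hC w)]
        refine integral_congr_ae ?_
        filter_upwards [Lp.coeFn_add z w] with y hy
        rw [hy, Pi.add_apply, mul_add]
      map_smul' := fun c z => by
        rw [RingHom.id_apply, smul_eq_mul, ← integral_const_mul]
        refine integral_congr_ae ?_
        filter_upwards [Lp.coeFn_smul c z] with y hy
        rw [hy, Pi.smul_apply, smul_eq_mul, mul_left_comm] }
  exact ⟨R₀.mkContinuous C fun z => abs_integral_mul_le hC z, fun z => rfl⟩

/-- The prescribed kernel evaluates the given coefficient pointwise, although that coefficient is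
measurable and bounded only almost everywhere. Measurability and bounds are proved for this
truncated representative and carried back along null sets. -/
lemma exists_bounded_measurable_representative {g : ℝ → ℝ} (hg : MemLp g ⊤ unitMeasure) :
    ∃ (g' : ℝ → ℝ) (C : ℝ), Measurable g' ∧ (∀ x, |g' x| ≤ C) ∧ g =ᵐ[unitMeasure] g' := by
  set C := (eLpNorm g ⊤ unitMeasure).toReal with hCdef
  have hC : ∀ᵐ x ∂unitMeasure, |g x| ≤ C := by
    filter_upwards [ae_le_eLpNormEssSup (f := g) (μ := unitMeasure)] with x hx
    rw [← eLpNorm_exponent_top] at hx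
    have := ENNReal.toReal_mono hg.2.ne hx
    simpa [hCdef] using this
  refine ⟨fun x => max (-C) (min C (hg.1.mk g x)), C,
    measurable_const.max (measurable_const.min hg.1.stronglyMeasurable_mk.measurable),
    fun x => abs_le.2 ⟨le_max_left _ _, max_le (neg_le_self ENNReal.toReal_nonneg)
      (min_le_left _ _)⟩, ?_⟩
  filter_upwards [hC, hg.1.ae_eq_mk] with x h1 h2
  rw [← h2, min_eq_right (le_of_abs_le h1), max_eq_right (neg_le_of_abs_le h1)]

open Classical in
/-- The kernel transported from the boundary values `g` along the characteristics of the pair of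
speeds `l`, `l'`. -/
def cascadeKernel (l l' g : ℝ → ℝ) (x y : ℝ) : ℝ :=
  if x ∈ Icc (0 : ℝ) 1 ∧ y ∈ Icc (0 : ℝ) 1 ∧ travelExt l x ≤ travelExt l' y then
    g (position l (travelExt l x - travelExt l' y)) / (-speedExt l' y) else 0

section Kernel

variable {l l' : ℝ → ℝ} (hl : IsSpeed l) (hneg : ∀ x ∈ Icc (0 : ℝ) 1, l x < 0)
  (hl' : IsSpeed l') (hneg' : ∀ x ∈ Icc (0 : ℝ) 1, l' x < 0)

include hl hneg in
lemma mem_crossingTimes_iff_of_neg {τ s : ℝ} :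
    s ∈ crossingTimes l τ ↔ τ < s ∧ s < τ - travelExt l 1 := by
  have ha := travelExt_strictAnti hl hneg
  refine ⟨fun h => lt_of_mem_crossingTimes hl hneg h, fun ⟨h1, h2⟩ => ⟨?_, ?_⟩⟩
  · rw [← ha.lt_iff_gt, hl.travelExt_position, travelExt_zero]
    linarith
  · rw [← ha.lt_iff_gt, hl.travelExt_position]
    linarith

include hl' hneg' in
lemma travelExt_nonpos {y : ℝ} (hy : 0 ≤ y) : travelExt l' y ≤ 0 := by
  rw [← travelExt_zero l']
  exact (travelExt_strictAnti hl' hneg').antitone hy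

include hl hneg hl' hneg' in
-- Since `φ'(y) ≤ 0`, the argument lies between `φ(x)`, which is at least `φ(1)`, and `0`. The
-- kernel thus never reads `g` outside `[0,1]`.
lemma position_mem_Icc {x y : ℝ} (hx : x ∈ Icc (0 : ℝ) 1) (hy : y ∈ Icc (0 : ℝ) 1)
    (h : travelExt l x ≤ travelExt l' y) :
    position l (travelExt l x - travelExt l' y) ∈ Icc (0 : ℝ) 1 := by
  have ha := travelExt_strictAnti hl hneg
  constructor
  · rw [← ha.le_iff_ge, hl.travelExt_position, travelExt_zero]
    linarith
  · rw [← ha.le_iff_ge, hl.travelExt_position]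
    linarith [ha.antitone hx.2, travelExt_nonpos hl' hneg' hy.1]

include hl in
lemma travelInv_eq_position {s : ℝ} (hs : position l s ∈ Icc (0 : ℝ) 1) :
    travelInv l s = position l s := by
  have hmem : ∃ x ∈ Icc (0 : ℝ) 1, travel l x = s :=
    ⟨_, hs, by rw [← travelExt_of_mem l hs, hl.travelExt_position]⟩
  have h1 : travelInv l s ∈ Icc (0 : ℝ) 1 := Function.invFunOn_mem hmem
  have h2 : travel l (travelInv l s) = s := Function.invFunOn_eq hmem
  rw [← travelExt_of_mem l h1] at h2
  rw [← h2, hl.position_travelExt, h2]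

include hl hneg hl' hneg' in
lemma cascadeKernel_eq (g : ℝ → ℝ) {x y : ℝ} (hx : x ∈ Icc (0 : ℝ) 1) (hy : y ∈ Icc (0 : ℝ) 1)
    (h : travel l x ≤ travel l' y) :
    cascadeKernel l l' g x y = g (travelInv l (travel l x - travel l' y)) / (-l' y) := by
  rw [← travelExt_of_mem l hx, ← travelExt_of_mem l' hy] at h ⊢
  rw [cascadeKernel, if_pos ⟨hx, hy, h⟩,
    travelInv_eq_position hl (position_mem_Icc hl hneg hl' hneg' hx hy h), speedExt_of_mem l' hy]

lemma cascadeKernel_eq_zero (l l' g : ℝ → ℝ) {x y : ℝ} (hx : x ∈ Icc (0 : ℝ) 1)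
    (hy : y ∈ Icc (0 : ℝ) 1) (h : travel l' y < travel l x) : cascadeKernel l l' g x y = 0 := by
  rw [← travelExt_of_mem l hx, ← travelExt_of_mem l' hy] at h
  rw [cascadeKernel, if_neg fun hh => hh.2.2.not_gt h]

include hl hl' in
lemma measurable_cascadeKernel {g : ℝ → ℝ} (hg : Measurable g) :
    Measurable (Function.uncurry (cascadeKernel l l' g)) := by
  have h1 : Measurable fun q : ℝ × ℝ => travelExt l q.1 :=
    hl.continuous_travelExt.measurable.comp measurable_fst
  have h2 : Measurable fun q : ℝ × ℝ => travelExt l' q.2 :=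
    hl'.continuous_travelExt.measurable.comp measurable_snd
  refine Measurable.ite ?_ ?_ measurable_const
  · exact (measurable_fst measurableSet_Icc).inter
      ((measurable_snd measurableSet_Icc).inter (measurableSet_le h1 h2))
  · exact (hg.comp (hl.continuous_position.measurable.comp (h1.sub h2))).div
      (hl'.continuous_ext.measurable.comp measurable_snd).neg

include hl' in
lemma exists_bound_cascadeKernel {g : ℝ → ℝ} {C : ℝ} (hC : ∀ x, |g x| ≤ C) :
    ∃ C', ∀ x y, |cascadeKernel l l' g x y| ≤ C' := by
  obtain ⟨B, hB⟩ := hl'.exists_bound_inv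
  have hC0 : 0 ≤ C := (abs_nonneg _).trans (hC 0)
  have hB0 : 0 ≤ B := (abs_nonneg _).trans (hB 0)
  refine ⟨C * B, fun x y => ?_⟩
  unfold cascadeKernel
  split_ifs
  · rw [abs_div, abs_neg, div_eq_mul_inv, ← abs_inv]
    exact mul_le_mul (hC _) (hB _) (abs_nonneg _) hC0
  · simpa using mul_nonneg hC0 hB0

lemma ae_mem_Icc_of_ae_unit {p : ℝ → Prop} (h : ∀ᵐ x ∂unitMeasure, p x) :
    ∀ᵐ x, x ∈ Icc (0 : ℝ) 1 → p x := by
  have : ∀ᵐ x ∂volume.restrict (Icc (0 : ℝ) 1), p x := by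
    rwa [← restrict_Ioo_eq_restrict_Icc]
  exact (ae_restrict_iff' measurableSet_Icc).1 this

include hl hl' in
lemma quasiMeasurePreserving_position_sub (c : ℝ) : Measure.QuasiMeasurePreserving
    (fun y => position l (c - travelExt l' y)) volume volume :=
  hl.quasiMeasurePreserving_position.comp
    ((Measure.measurePreserving_sub_left volume c).quasiMeasurePreserving.comp
      hl'.quasiMeasurePreserving_travelExt)

include hl hneg hl' hneg'

lemma cascadeKernel_congr {g g' : ℝ → ℝ} {x y : ℝ}
    (h : position l (travelExt l x - travelExt l' y) ∈ Icc (0 : ℝ) 1 →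
      g (position l (travelExt l x - travelExt l' y)) =
        g' (position l (travelExt l x - travelExt l' y))) :
    cascadeKernel l l' g x y = cascadeKernel l l' g' x y := by
  unfold cascadeKernel
  split_ifs with hc
  · rw [h (position_mem_Icc hl hneg hl' hneg' hc.1 hc.2.1 hc.2.2)]
  · rfl

/-- For fixed `x` the foot point of the characteristic depends on `y` through a map that pulls null
sets back to null sets. The statement is for every `x`, because the row `x = 1` defines the boundary
control. -/
lemma cascadeKernel_row_ae_eq {g g' : ℝ → ℝ} (hg : g =ᵐ[unitMeasure] g') (x : ℝ) :
    cascadeKernel l l' g x =ᵐ[unitMeasure] cascadeKernel l l' g' x := by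
  have := (quasiMeasurePreserving_position_sub hl hl' (travelExt l x)).ae
    (ae_mem_Icc_of_ae_unit hg)
  filter_upwards [ae_restrict_of_ae this] with y hy
  exact cascadeKernel_congr hl hneg hl' hneg' hy

lemma memLp_cascadeKernel {g : ℝ → ℝ} (hg : MemLp g ⊤ unitMeasure) :
    MemLp (fun q : ℝ × ℝ => cascadeKernel l l' g q.1 q.2) 2 (unitMeasure.prod unitMeasure) := by
  obtain ⟨g', C, hm, hC, hgg⟩ := exists_bounded_measurable_representative hg
  obtain ⟨C', hC'⟩ := exists_bound_cascadeKernel (l := l) hl' hC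
  have hb : MemLp (fun q : ℝ × ℝ => cascadeKernel l l' g' q.1 q.2) 2
      (unitMeasure.prod unitMeasure) :=
    MemLp.of_bound (measurable_cascadeKernel hl hl' hm).aestronglyMeasurable C'
      (.of_forall fun q => hC' _ _)
  refine hb.ae_eq ?_
  -- The exceptional set of `g` is enlarged to a measurable null set so that its pullback to the
  -- square can be shown null slice by slice.
  obtain ⟨N, hN, hNm, hN0⟩ := exists_measurable_superset_of_null
    (ae_iff.1 (ae_mem_Icc_of_ae_unit hgg))
  have hmeas : MeasurableSet {q : ℝ × ℝ | position l (travelExt l q.1 - travelExt l' q.2) ∉ N} :=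
    (hl.continuous_position.measurable.comp
      ((hl.continuous_travelExt.measurable.comp measurable_fst).sub
        (hl'.continuous_travelExt.measurable.comp measurable_snd))) hNm.compl
  have hae : ∀ᵐ q ∂unitMeasure.prod unitMeasure,
      position l (travelExt l q.1 - travelExt l' q.2) ∉ N := by
    rw [Measure.ae_prod_iff_ae_ae hmeas]
    refine .of_forall fun x => ae_restrict_of_ae ?_
    exact (quasiMeasurePreserving_position_sub hl hl' (travelExt l x)).ae
      (measure_eq_zero_iff_ae_notMem.1 hN0)
  filter_upwards [hae] with q hq
  refine (cascadeKernel_congr hl hneg hl' hneg' fun h => ?_).symm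
  by_contra hne
  exact hq (hN fun hh => hne (hh h))

lemma exists_cascadeOperator {g : ℝ → ℝ} (hg : MemLp g ⊤ unitMeasure) :
    ∃ T : Lp ℝ 2 unitMeasure →L[ℝ] Lp ℝ 2 unitMeasure,
      ∀ z, T z =ᵐ[unitMeasure] fun x => ∫ y, cascadeKernel l l' g x y * z y ∂unitMeasure := by
  obtain ⟨g', C, hm, hC, hgg⟩ := exists_bounded_measurable_representative hg
  obtain ⟨C', hC'⟩ := exists_bound_cascadeKernel (l := l) hl' hC
  obtain ⟨T, hT⟩ := exists_integralOperator (measurable_cascadeKernel hl hl' hm) hC'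
  refine ⟨T, fun z => (hT z).trans (.of_forall fun x => integral_congr_ae ?_)⟩
  filter_upwards [cascadeKernel_row_ae_eq hl hneg hl' hneg' hgg x] with y hy
  rw [hy]

lemma exists_cascadeFunctional {g : ℝ → ℝ} (hg : MemLp g ⊤ unitMeasure) (x : ℝ) :
    ∃ R : Lp ℝ 2 unitMeasure →L[ℝ] ℝ,
      ∀ z, R z = ∫ y, cascadeKernel l l' g x y * z y ∂unitMeasure := by
  obtain ⟨g', C, hm, hC, hgg⟩ := exists_bounded_measurable_representative hg
  obtain ⟨C', hC'⟩ := exists_bound_cascadeKernel (l := l) hl' hC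
  have hae := cascadeKernel_row_ae_eq hl hneg hl' hneg' hgg x
  refine exists_integralFunctional (C := C') (((measurable_cascadeKernel hl hl' hm).comp
    (measurable_prodMk_left (x := x))).aestronglyMeasurable.congr hae.symm) ?_
  filter_upwards [hae] with y hy
  rw [hy]
  exact hC' x y

end Kernel

/-! ### The kernel turns waves of one speed into sources for another. -/

lemma measurable_exitProfile {l : ℝ → ℝ} (hl : IsSpeed l) (v : Lp ℝ 2 unitMeasure) :
    Measurable (exitProfile l v) :=
  ((Lp.stronglyMeasurable v).measurable.comp (hl.continuous_position.measurable.comp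
    (measurable_const.sub measurable_id))).indicator (hl.measurableSet_crossingTimes 0)

lemma integrable_exitProfile {l : ℝ → ℝ} (hl : IsSpeed l) (v : Lp ℝ 2 unitMeasure) :
    Integrable (exitProfile l v) :=
  (integrable_indicator_iff (hl.measurableSet_crossingTimes 0)).2
    (hl.integrableOn_crossingTimes 0 (integrable_coeFn v))

section Pair

variable {l l' : ℝ → ℝ} (hl : IsSpeed l) (hneg : ∀ x ∈ Icc (0 : ℝ) 1, l x < 0)
  (hl' : IsSpeed l') (hneg' : ∀ x ∈ Icc (0 : ℝ) 1, l' x < 0)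
include hl hneg hl' hneg'

/-- The kernel operator turns the waves of the speed `l'` into superpositions of waves of the
speed `l`. -/
lemma integral_cascadeKernel_eq_duhamel (g : ℝ → ℝ) {α : ℝ → ℝ}
    (hα : ∀ s, s ∉ crossingTimes l' 0 → α s = 0) {x t : ℝ} (hx : x ∈ Icc (0 : ℝ) 1) (ht : 0 ≤ t) :
    ∫ y, cascadeKernel l l' g x y * α (t - travelExt l' y) ∂unitMeasure =
      duhamel l (fun ξ => g ξ / -speedExt l ξ) α t x := by
  classical
  set c := travelExt l x with hcdef
  set E : ℝ → ℝ := fun σ => g (position l (c + σ)) * α (t + σ) with hE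
  have habs : ∀ {k : ℝ → ℝ}, (∀ x ∈ Icc (0 : ℝ) 1, k x < 0) → ∀ y ∈ Ioo (0 : ℝ) 1,
      |(k y)⁻¹| = 1 / -speedExt k y := fun {k} hk y hy => by
    rw [speedExt_of_mem k (Ioo_subset_Icc_self hy),
      abs_of_neg (inv_lt_zero.2 (hk y (Ioo_subset_Icc_self hy))), one_div, inv_neg]
  -- Substitution `σ = -φ'(y)`, which absorbs the denominator of the kernel.
  have left : ∫ y, cascadeKernel l l' g x y * α (t - travelExt l' y) ∂unitMeasure =
      ∫ σ, (crossingTimes l' 0 ∩ Iic (-c)).indicator E σ := by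
    rw [← indicator_indicator, integral_indicator (hl'.measurableSet_crossingTimes 0),
      hl'.setIntegral_crossingTimes]
    refine setIntegral_congr_fun measurableSet_Ioo fun y hy => ?_
    simp only [habs hneg' y hy, cascadeKernel, indicator_apply, mem_Iic, hE, zero_sub,
      neg_le_neg_iff, hx, Ioo_subset_Icc_self hy, true_and, ← hcdef, ← sub_eq_add_neg]
    split_ifs <;> ring
  -- Substitution `σ = φ(ξ) - φ(x)`, under which `ξ` is the point with travel time `φ(x) + σ`; both
  -- sides now have the integrand `E`.
  have right : duhamel l (fun ξ => g ξ / -speedExt l ξ) α t x =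
      ∫ σ, ((fun σ => -c - σ) ⁻¹' crossingTimes l 0 ∩ Ioi 0).indicator E σ := by
    have h1 : duhamel l (fun ξ => g ξ / -speedExt l ξ) α t x =
        ∫ s, (crossingTimes l 0).indicator (fun s => (Ioi 0).indicator E (-c - s)) s := by
      rw [integral_indicator (hl.measurableSet_crossingTimes 0), hl.setIntegral_crossingTimes]
      refine setIntegral_congr_fun measurableSet_Ioo fun ξ hξ => ?_
      have hiff : 0 < -c - (0 - travelExt l ξ) ↔ ξ < x := by
        have := (travelExt_strictAnti hl hneg).lt_iff_gt (a := x) (b := ξ)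
        rw [← this, ← hcdef]
        constructor <;> intro h <;> linarith
      simp only [habs hneg ξ hξ, delayedWave, indicator_apply, mem_Ioi, hiff, hE]
      rw [show c + (-c - (0 - travelExt l ξ)) = travelExt l ξ by ring, hl.position_travelExt,
        show t + (-c - (0 - travelExt l ξ)) = t + travelExt l ξ - travelExt l x by
          rw [hcdef]; ring]
      split_ifs <;> ring
    rw [h1, ← integral_sub_left_eq_self (fun s => (crossingTimes l 0).indicator
      (fun s => (Ioi 0).indicator E (-c - s)) s) volume (-c)]
    congr 1
    ext σ
    rw [← indicator_indicator]
    simp only [indicator_apply, mem_preimage, sub_sub_cancel]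
  rw [left, right]
  refine integral_congr_ae ?_
  have hne : ∀ᵐ σ : ℝ, σ ≠ -c := by simp [ae_iff, measure_singleton]
  filter_upwards [hne] with σ hσ
  -- The left side alone carries the cutoff `σ < -φ'(1)`. Where `α(t + σ)` can be nonzero, `t + σ <
  -- -φ'(1)` and `t ≥ 0` make this cutoff automatic, so no comparison of the two speeds is needed.
  -- The ranges then differ only at the excluded endpoint `σ = -φ(x)`.
  by_cases hz : t + σ ∈ crossingTimes l' 0
  · have hc1 : travelExt l 1 ≤ c := (travelExt_strictAnti hl hneg).antitone hx.2
    rw [mem_crossingTimes_iff_of_neg hl' hneg'] at hz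
    have : σ ∈ crossingTimes l' 0 ∩ Iic (-c) ↔
        σ ∈ (fun σ => -c - σ) ⁻¹' crossingTimes l 0 ∩ Ioi 0 := by
      simp only [mem_inter_iff, mem_preimage, mem_crossingTimes_iff_of_neg hl' hneg',
        mem_crossingTimes_iff_of_neg hl hneg, mem_Iic, mem_Ioi]
      constructor
      · rintro ⟨⟨h1, h2⟩, h3⟩
        have := lt_of_le_of_ne h3 hσ
        exact ⟨⟨by linarith, by linarith⟩, h1⟩
      · rintro ⟨⟨h1, h2⟩, h3⟩
        exact ⟨⟨h3, by linarith [hz.2]⟩, by linarith⟩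
    simp only [indicator_apply, this]
  · have : E σ = 0 := by simp [hE, hα _ hz]
    simp only [indicator_apply, this, ite_self]

variable (hc : ContDiffOn ℝ 1 l (Icc 0 1)) (hc' : ContDiffOn ℝ 1 l' (Icc 0 1))
include hc hc'

/-- The kernel operator applied to a homogeneous transport equation with speed `l'` and zero inflow
gives a transport equation with speed `l`, zero outflow trace and source `-g(x) a(t)`. -/
lemma IsTransport.cascade {g : ℝ → ℝ} (hg : MemLp g ⊤ unitMeasure)
    {T : Lp ℝ 2 unitMeasure →L[ℝ] Lp ℝ 2 unitMeasure}
    (hT : ∀ z, T z =ᵐ[unitMeasure] fun x => ∫ y, cascadeKernel l l' g x y * z y ∂unitMeasure)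
    {R : Lp ℝ 2 unitMeasure →L[ℝ] ℝ}
    (hR : ∀ z, R z = ∫ y, cascadeKernel l l' g 1 y * z y ∂unitMeasure)
    {u : ℝ → Lp ℝ 2 unitMeasure} {a b : ℝ → ℝ} (h : IsTransport l' u a b fun _ _ => 0)
    (hb0 : ∀ᵐ t ∂volume.restrict (Ioi (0 : ℝ)), b t = 0) :
    IsTransport l (fun t => T (u t)) (fun _ => 0) (fun t => R (u t))
      (fun t x => -(g x * a t)) where
  continuousOn := T.continuous.comp_continuousOn h.continuousOn
  integrable_left T := by simp
  integrable_right τ := (((R.continuous.comp_continuousOn h.continuousOn).mono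
    (fun t ht => ht.1 : Icc 0 τ ⊆ Ici 0)).integrableOn_Icc).mono_set Ioo_subset_Icc_self
  integrable_source τ := by
    have hgi : Integrable g unitMeasure := hg.integrable le_top
    have := ((h.integrable_left τ).mul_prod hgi).neg
    refine this.congr (.of_forall fun q => ?_)
    simp [Function.uncurry, mul_comm]
  weak := by
    rw [weakTransport_iff hc]
    intro τ hτ θ Θ D hext
    obtain ⟨B, hB⟩ := hext.bounded
    obtain ⟨g', C, hm, hC, hgg⟩ := exists_bounded_measurable_representative hg
    obtain ⟨C₁, hC₁⟩ := hl.exists_bound_inv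
    obtain ⟨L, -, hL⟩ := exists_bound_speedExt hl.continuousOn
    set α := exitProfile l' (u 0) with hαdef
    have hαm : Measurable α := measurable_exitProfile hl' _
    have hαi : Integrable α := integrable_exitProfile hl' _
    set κ : ℝ → ℝ := fun ξ => g' ξ / -speedExt l ξ with hκ
    have hκm : Measurable κ := hm.div hl.continuous_ext.measurable.neg
    have hκb : ∀ ξ, |κ ξ| ≤ C * C₁ := fun ξ => by
      rw [hκ, abs_div, abs_neg, div_eq_mul_inv, ← abs_inv]
      exact mul_le_mul (hC _) (hC₁ _) (abs_nonneg _) ((abs_nonneg _).trans (hC 0))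
    -- Valid for every `x` in the closed interval: the value at `x = 1` is the outflow functional
    -- `R`.
    have rep : ∀ t, 0 ≤ t → ∀ x ∈ Icc (0 : ℝ) 1,
        ∫ y, cascadeKernel l l' g x y * u t y ∂unitMeasure = duhamel l κ α t x := by
      intro t ht x hx
      rw [← integral_cascadeKernel_eq_duhamel hl hneg hl' hneg' g' (α := α)
        (fun s hs => indicator_of_notMem hs _) hx ht]
      refine integral_congr_ae ?_
      filter_upwards [cascadeKernel_row_ae_eq hl hneg hl' hneg' hgg x,
        h.weak.eq_exitProfile hl' hneg' hc' h.integrable_left hb0 ht] with y h1 h2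
      rw [h1, h2]
    have repT : ∀ t, 0 ≤ t → ∀ m : ℝ → ℝ, ∫ x, m x * T (u t) x ∂unitMeasure =
        ∫ x, m x * duhamel l κ α t x ∂unitMeasure := by
      intro t ht m
      refine integral_congr_ae ?_
      filter_upwards [hT (u t), ae_restrict_mem measurableSet_Ioo] with x h1 h2
      rw [h1, rep t ht x (Ioo_subset_Icc_self h2)]
    have main := hl.green_duhamel hκm hκb hc hτ hext hαm hαi
    have sm := hl.stronglyMeasurable_duhamel hκm hαm
    have bd := hl.abs_duhamel_le hκm hκb hL hαm hαi
    have hDi : Integrable (fun q : ℝ × ℝ => D q * duhamel l κ α q.1 q.2)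
        ((volume.restrict (Ioo 0 τ)).prod unitMeasure) :=
      (Integrable.of_bound sm.aestronglyMeasurable _ (.of_forall fun q => bd q.1 q.2)).bdd_mul
        hext.continuous_div.aestronglyMeasurable (.of_forall fun q => (hB q).2)
    rw [integral_prod _ hDi] at main
    have e3 : ∫ t in Ioo 0 τ, ∫ x, D (t, x) * T (u t) x ∂unitMeasure =
        ∫ t in Ioo 0 τ, ∫ x, D (t, x) * duhamel l κ α t x ∂unitMeasure :=
      setIntegral_congr_fun measurableSet_Ioo fun t ht => repT t ht.1.le _
    have e4 : ∫ t in Ioo 0 τ, (l 0 * Θ (t, 0) * 0 - l 1 * Θ (t, 1) * R (u t)) =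
        -∫ t in Ioo 0 τ, l 1 * Θ (t, 1) * duhamel l κ α t 1 := by
      rw [← integral_neg]
      refine setIntegral_congr_fun measurableSet_Ioo fun t ht => ?_
      simp only [hR, rep t ht.1.le 1 ⟨zero_le_one, le_rfl⟩]
      ring
    -- The weight `κ` is chosen so that `κ · l = -g`, and the left trace of `u` is the wave profile
    -- `α`; the boundary terms of Green's formula are thereby the source term.
    have e5 : ∫ t in Ioo 0 τ, ∫ x, Θ (t, x) * -(g x * a t) ∂unitMeasure =
        ∫ t in Ioo 0 τ, (∫ ξ, κ ξ * (speedExt l ξ * Θ (t, ξ)) ∂unitMeasure) * α t := by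
      have ha : ∀ᵐ t ∂volume.restrict (Ioo 0 τ), a t = α t :=
        ae_restrict_of_ae_restrict_of_subset (fun t ht => ht.1)
        (h.weak.left_trace_eq_exitProfile hl' hneg' hc' h.integrable_left hb0)
      refine integral_congr_ae ?_
      filter_upwards [ha] with t ht
      rw [← integral_mul_const, ht]
      refine integral_congr_ae ?_
      filter_upwards [hgg] with x hx
      have := hl.ext_ne_zero x
      rw [hx, hκ]
      field_simp
    rw [repT τ hτ.le, repT 0 le_rfl, e3, e4, e5]
    linear_combination main

end Pair

/-! ### The triangular transform, uniqueness for the system and the boundary control. -/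

/-- The identity minus a strictly lower triangular matrix of operators is invertible. -/
lemma exists_unitriangular_equiv {E : Type*} [NormedAddCommGroup E] [NormedSpace ℝ E] {m p : ℕ}
    (T : Fin m → Fin m → E →L[ℝ] E) (hT : ∀ i j, i ≤ j → T i j = 0) :
    ∃ F : (Fin m ⊕ Fin p → E) ≃L[ℝ] (Fin m ⊕ Fin p → E),
      (∀ z i, F z (Sum.inl i) = z (Sum.inl i) - ∑ j, T i j (z (Sum.inl j))) ∧
      ∀ z k, F z (Sum.inr k) = z (Sum.inr k) := by
  let N : (Fin m ⊕ Fin p → E) →L[ℝ] (Fin m ⊕ Fin p → E) :=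
    ContinuousLinearMap.pi (Sum.elim
      (fun i => ∑ j, (T i j).comp (ContinuousLinearMap.proj (Sum.inl j))) fun _ => 0)
  have hl : ∀ z i, N z (Sum.inl i) = ∑ j, T i j (z (Sum.inl j)) := fun z i => by simp [N]
  have hr : ∀ z k, N z (Sum.inr k) = 0 := fun z k => by simp [N]
  -- Each application of `N` kills one more leading component.
  have hpow : ∀ (k : ℕ) z (i : Fin m), (i : ℕ) < k → (N ^ k) z (Sum.inl i) = 0 := by
    intro k
    induction k with
    | zero => exact fun z i hi => absurd hi (Nat.not_lt_zero _)
    | succ k ih =>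
      intro z i hi
      rw [pow_succ', mul_apply_eq_comp, hl]
      refine Finset.sum_eq_zero fun j _ => ?_
      rcases le_or_gt i j with hij | hij
      · rw [hT i j hij, zero_apply]
      · rw [ih z j (by omega), map_zero]
  -- The exponent `m + 1` leaves at least one factor `N` to kill the positive components even when
  -- `m = 0`.
  have hnil : N ^ (m + 1) = 0 := by
    ext z i
    rcases i with i | k
    · rw [hpow (m + 1) z i (by omega)]
      rfl
    · rw [pow_succ', mul_apply_eq_comp, hr]
      rfl
  obtain ⟨U, hU⟩ := IsNilpotent.isUnit_one_sub ⟨m + 1, hnil⟩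
  have hF : ∀ z, ContinuousLinearEquiv.unitsEquiv ℝ _ U z = z - N z := fun z => by
    rw [ContinuousLinearEquiv.unitsEquiv_apply, hU]
    rfl
  refine ⟨ContinuousLinearEquiv.unitsEquiv ℝ _ U, fun z i => ?_, fun z k => ?_⟩
  · rw [hF, Pi.sub_apply, hl]
  · rw [hF, Pi.sub_apply, hr, sub_zero]

lemma isTransport_zero (l : ℝ → ℝ) :
    IsTransport l (fun _ => 0) (fun _ => 0) (fun _ => 0) fun _ _ => 0 where
  weak τ _ θ _ := by
    have h : ∀ v : ℝ → ℝ, ∫ x, v x * (0 : Lp ℝ 2 unitMeasure) x ∂unitMeasure = 0 := fun v => by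
      rw [integral_congr_ae (g := fun _ => (0 : ℝ)), integral_zero]
      filter_upwards [Lp.coeFn_zero ℝ 2 unitMeasure] with x hx
      rw [hx, Pi.zero_apply, mul_zero]
    simp
  continuousOn := continuousOn_const
  integrable_left _ := by simp
  integrable_right _ := by simp
  integrable_source _ := integrable_zero _ _ _

namespace IsSpeedFamily

variable {m p : ℕ} {lam : Idx m p → ℝ → ℝ} (h : IsSpeedFamily lam)
include h

lemma isSpeed_inl (i : Fin m) : IsSpeed (lam (Sum.inl i)) :=
  ⟨(h.contDiffOn _).continuousOn, .inl (h.neg i)⟩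

lemma isSpeed_inr (k : Fin p) : IsSpeed (lam (Sum.inr k)) :=
  ⟨(h.contDiffOn _).continuousOn, .inr (h.pos k)⟩

end IsSpeedFamily

section System

variable {m p : ℕ} {lam : Idx m p → ℝ → ℝ} {G : Idx m p → Idx m p → ℝ → ℝ}

lemma isTransport_of_weak (hG : ∀ i j, MemLp (G i j) ⊤ unitMeasure) {u : ℝ → State m p}
    (hu : ContinuousOn u (Ici 0)) {a b : Idx m p → ℝ → ℝ}
    (hab : ∀ i, ∀ T : ℝ, MemLp (a i) 2 (volume.restrict (Ioo 0 T)) ∧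
      MemLp (b i) 2 (volume.restrict (Ioo 0 T)))
    {i : Idx m p} (hw : WeakTransport (lam i) (fun t => u t i) (a i) (b i)
      (fun t x => ∑ j, G i j x * a j t)) :
    IsTransport (lam i) (fun t => u t i) (a i) (b i) (fun t x => ∑ j, G i j x * a j t) where
  weak := hw
  continuousOn := (continuous_apply i).comp_continuousOn hu
  integrable_left T := (hab i T).1.integrable one_le_two
  integrable_right T := (hab i T).2.integrable one_le_two
  integrable_source T := by
    have : ∀ j, Integrable (fun q : ℝ × ℝ => G i j q.2 * a j q.1)
        ((volume.restrict (Ioo 0 T)).prod unitMeasure) := fun j => by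
      simpa only [mul_comm] using
        ((hab j T).1.integrable one_le_two).mul_prod ((hG i j).integrable le_top)
    exact integrable_finsetSum _ fun j _ => this j

lemma memLp_of_continuousOn {v : ℝ → ℝ} (hv : ContinuousOn v (Ici 0)) (T : ℝ) :
    MemLp v 2 (volume.restrict (Ioo 0 T)) := by
  have hc : ContinuousOn v (Icc 0 T) := hv.mono fun t ht => ht.1
  obtain ⟨C, hC⟩ := isCompact_Icc.exists_bound_of_continuousOn hc
  have hc' : ContinuousOn v (Ioo 0 T) := hc.mono Ioo_subset_Icc_self
  refine MemLp.of_bound (hc'.aestronglyMeasurable measurableSet_Ioo) C ?_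
  filter_upwards [ae_restrict_mem measurableSet_Ioo] with t ht
  exact hC t (Ioo_subset_Icc_self ht)

/-- Weak solutions of the cascade system are determined by their initial data, if each boundary
control only depends on the preceding components. -/
lemma IsWeakSolution.eq_of_initial_eq (hlam : IsSpeedFamily lam) (hG : IsCascadeMatrix G)
    {Q : Matrix (Fin p) (Fin m) ℝ} {H : State m p →L[ℝ] (Fin m → ℝ)}
    (hH : ∀ (w w' : State m p) (i : Fin m),
      (∀ j < i, w (Sum.inl j) = w' (Sum.inl j)) → H w i = H w' i)
    {u u' : ℝ → State m p} (hu : IsWeakSolution lam G Q H u) (hu' : IsWeakSolution lam G Q H u')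
    (h0 : u 0 = u' 0) {t : ℝ} (ht : 0 ≤ t) : u t = u' t := by
  obtain ⟨hcont, a, b, hab, hw, hb, ha⟩ := hu
  obtain ⟨hcont', a', b', hab', hw', hb', ha'⟩ := hu'
  have hd : ∀ i, IsTransport (lam i) (fun t => u t i + (-1 : ℝ) • u' t i)
      (fun t => a i t + -1 * a' i t) (fun t => b i t + -1 * b' i t)
      (fun t x => ∑ j, G i j x * a j t + -1 * ∑ j, G i j x * a' j t) := fun i =>
    (isTransport_of_weak hG.memLp hcont hab (hw i)).add_smul (hlam.contDiffOn i)
      (isTransport_of_weak hG.memLp hcont' hab' (hw' i)) (-1)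
  have hd0 : ∀ i, u 0 i + (-1 : ℝ) • u' 0 i = 0 := fun i => by rw [h0]; simp
  -- Strong induction on `i`. Earlier traces agree, so the sources agree; earlier states agree, so
  -- the controls agree. The traces must be carried along with the states because the sources
  -- involve them.
  have neg : ∀ i : Fin m, (∀ t, 0 ≤ t → u t (Sum.inl i) = u' t (Sum.inl i)) ∧
      ∀ᵐ t ∂volume.restrict (Ioi (0 : ℝ)), a (Sum.inl i) t = a' (Sum.inl i) t := by
    intro i
    induction i using WellFoundedLT.induction with
    | _ i ih =>
      have hsource : ∀ᵐ t ∂volume.restrict (Ioi (0 : ℝ)), (fun x => ∑ j, G (Sum.inl i) j x * a j t +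
          -1 * ∑ j, G (Sum.inl i) j x * a' j t) = fun _ => 0 := by
        filter_upwards [ae_all_iff.2 fun j : Fin m => ae_all_iff.2 fun hj : j < i => (ih j hj).2]
          with t h1
        ext x
        have : ∑ j, G (Sum.inl i) j x * a j t = ∑ j, G (Sum.inl i) j x * a' j t := by
          refine Finset.sum_congr rfl fun j _ => ?_
          rcases j with j | k
          · rcases lt_or_ge j i with hji | hij
            · rw [h1 j hji]
            · rw [hG.upper_eq_zero i j hij, zero_mul, zero_mul]
          · rw [hG.right_eq_zero, zero_mul, zero_mul]
        rw [this]
        ring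
      have hbz : ∀ᵐ t ∂volume.restrict (Ioi (0 : ℝ)),
          b (Sum.inl i) t + -1 * b' (Sum.inl i) t = 0 := by
        filter_upwards [hb, hb', ae_restrict_mem measurableSet_Ioi] with t h1 h2 hpos
        rw [h1 i, h2 i, hH (u t) (u' t) i fun j hj => (ih j hj).1 t (le_of_lt hpos)]
        ring
      have hweak := (hd (Sum.inl i)).weak.congr (fun _ _ => rfl) (.of_forall fun _ => rfl)
        (.of_forall fun _ => rfl) hsource
      obtain ⟨h1, h2⟩ := hweak.eq_zero_of_neg (hlam.isSpeed_inl i) (hlam.neg i)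
        (hlam.contDiffOn _) (hd (Sum.inl i)).integrable_left hbz (hd0 _)
      refine ⟨fun t ht => ?_, h2.mono fun t ht => by linarith⟩
      have := h1 t ht
      rwa [neg_one_smul, ← sub_eq_add_neg, sub_eq_zero] at this
  have all := ae_all_iff.2 fun j => (neg j).2
  ext1 i
  rcases i with i | k
  · exact (neg i).1 t ht
  -- Positive components are driven only by negative traces, through `G₂` in the interior and `Q` at
  -- the inflow `x = 0`, and these are already known to agree.
  · have hsource : ∀ᵐ t ∂volume.restrict (Ioi (0 : ℝ)), (fun x => ∑ j, G (Sum.inr k) j x * a j t +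
        -1 * ∑ j, G (Sum.inr k) j x * a' j t) = fun _ => 0 := by
      filter_upwards [all] with t h1
      ext x
      simp [Fintype.sum_sum_type, hG.right_eq_zero, h1]
    have haz : ∀ᵐ t ∂volume.restrict (Ioi (0 : ℝ)),
        a (Sum.inr k) t + -1 * a' (Sum.inr k) t = 0 := by
      filter_upwards [ha, ha', all] with t h1 h2 h3
      rw [h1, h2]
      simp [h3]
    have hweak := (hd (Sum.inr k)).weak.congr (fun _ _ => rfl) (.of_forall fun _ => rfl)
      (.of_forall fun _ => rfl) hsource
    have := hweak.eq_zero_of_pos (hlam.isSpeed_inr k) (hlam.pos k) (hlam.contDiffOn _)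
      (hd (Sum.inr k)).integrable_right haz (hd0 _) ht
    rwa [neg_one_smul, ← sub_eq_add_neg, sub_eq_zero] at this

/-- The operators of the Fredholm transform `F` that removes the source terms of the components with
negative speed, and the resulting boundary control `H`. -/
structure IsCascadeTransform (lam : Idx m p → ℝ → ℝ) (G : Idx m p → Idx m p → ℝ → ℝ)
    (T : Fin m → Fin m → Lp ℝ 2 unitMeasure →L[ℝ] Lp ℝ 2 unitMeasure)
    (R : Fin m → Fin m → Lp ℝ 2 unitMeasure →L[ℝ] ℝ) (F : State m p ≃L[ℝ] State m p)
    (H : State m p →L[ℝ] (Fin m → ℝ)) : Prop where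
  operator_zero : ∀ i j, i ≤ j → T i j = 0
  operator_eq : ∀ i j, j < i → ∀ z, T i j z =ᵐ[unitMeasure] fun x =>
    ∫ y, cascadeKernel (lam (Sum.inl i)) (lam (Sum.inl j)) (G (Sum.inl i) (Sum.inl j)) x y * z y
      ∂unitMeasure
  functional_zero : ∀ i j, i ≤ j → R i j = 0
  functional_eq : ∀ i j, j < i → ∀ z, R i j z =
    ∫ y, cascadeKernel (lam (Sum.inl i)) (lam (Sum.inl j)) (G (Sum.inl i) (Sum.inl j)) 1 y * z y
      ∂unitMeasure
  transform_inl : ∀ z i, F z (Sum.inl i) = z (Sum.inl i) - ∑ j, T i j (z (Sum.inl j))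
  transform_inr : ∀ z k, F z (Sum.inr k) = z (Sum.inr k)
  control : ∀ z i, H (F z) i = -∑ j, R i j (z (Sum.inl j))

lemma exists_cascadeTransform (hlam : IsSpeedFamily lam) (hG : IsCascadeMatrix G) :
    ∃ T R F H, IsCascadeTransform lam G T R F H := by
  have hTex : ∀ i j : Fin m, ∃ T : Lp ℝ 2 unitMeasure →L[ℝ] Lp ℝ 2 unitMeasure,
      (i ≤ j → T = 0) ∧ (j < i → ∀ z, T z =ᵐ[unitMeasure] fun x =>
        ∫ y, cascadeKernel (lam (Sum.inl i)) (lam (Sum.inl j)) (G (Sum.inl i) (Sum.inl j)) x y * z y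
          ∂unitMeasure) := fun i j => by
    rcases lt_or_ge j i with h | h
    · obtain ⟨T, hT⟩ := exists_cascadeOperator (hlam.isSpeed_inl i) (hlam.neg i)
        (hlam.isSpeed_inl j) (hlam.neg j) (hG.memLp (Sum.inl i) (Sum.inl j))
      exact ⟨T, fun h' => absurd h h'.not_gt, fun _ => hT⟩
    · exact ⟨0, fun _ => rfl, fun h' => absurd h' h.not_gt⟩
  have hRex : ∀ i j : Fin m, ∃ R : Lp ℝ 2 unitMeasure →L[ℝ] ℝ,
      (i ≤ j → R = 0) ∧ (j < i → ∀ z, R z =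
        ∫ y, cascadeKernel (lam (Sum.inl i)) (lam (Sum.inl j)) (G (Sum.inl i) (Sum.inl j)) 1 y * z y
          ∂unitMeasure) := fun i j => by
    rcases lt_or_ge j i with h | h
    · obtain ⟨R, hR⟩ := exists_cascadeFunctional (hlam.isSpeed_inl i) (hlam.neg i)
        (hlam.isSpeed_inl j) (hlam.neg j) (hG.memLp (Sum.inl i) (Sum.inl j)) 1
      exact ⟨R, fun h' => absurd h h'.not_gt, fun _ => hR⟩
    · exact ⟨0, fun _ => rfl, fun h' => absurd h' h.not_gt⟩
  choose T hT using hTex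
  choose R hR using hRex
  obtain ⟨F, hFl, hFr⟩ := exists_unitriangular_equiv (p := p) T fun i j h => (hT i j).1 h
  -- `H₀` is the trace at `x = 1` as a functional of the target state `z`; composing with `F⁻¹`
  -- turns it into feedback on the transformed state.
  let H₀ : State m p →L[ℝ] (Fin m → ℝ) := ContinuousLinearMap.pi fun i =>
    -∑ j, (R i j).comp (ContinuousLinearMap.proj (Sum.inl j))
  exact ⟨T, R, F, H₀.comp (F.symm : State m p →L[ℝ] State m p), fun i j => (hT i j).1,
    fun i j => (hT i j).2, fun i j => (hR i j).1, fun i j => (hR i j).2, hFl, hFr,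
    fun z i => by simp [H₀]⟩

namespace IsCascadeTransform

variable {T : Fin m → Fin m → Lp ℝ 2 unitMeasure →L[ℝ] Lp ℝ 2 unitMeasure}
  {R : Fin m → Fin m → Lp ℝ 2 unitMeasure →L[ℝ] ℝ} {F : State m p ≃L[ℝ] State m p}
  {H : State m p →L[ℝ] (Fin m → ℝ)} (h : IsCascadeTransform lam G T R F H)
include h

/-- Forward substitution: row `j` of `F` recovers component `j` of `z` from the earlier ones. Hence
`F⁻¹` is lower triangular as well. -/
lemma eq_of_transform_eq {z z' : State m p} {i : Fin m}
    (hw : ∀ j < i, F z (Sum.inl j) = F z' (Sum.inl j)) (j : Fin m) (hj : j < i) :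
    z (Sum.inl j) = z' (Sum.inl j) := by
  induction j using WellFoundedLT.induction with
  | _ j ih =>
    have h1 := hw j hj
    rw [h.transform_inl, h.transform_inl] at h1
    have : ∑ k, T j k (z (Sum.inl k)) = ∑ k, T j k (z' (Sum.inl k)) := by
      refine Finset.sum_congr rfl fun k _ => ?_
      rcases lt_or_ge k j with hk | hk
      · rw [ih k hk (hk.trans hj)]
      · rw [h.operator_zero j k hk]
        rfl
    rw [this] at h1
    exact sub_left_injective h1

lemma control_congr (w w' : State m p) (i : Fin m)
    (hw : ∀ j < i, w (Sum.inl j) = w' (Sum.inl j)) : H w i = H w' i := by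
  rw [← F.apply_symm_apply w, ← F.apply_symm_apply w'] at hw ⊢
  rw [h.control, h.control]
  congr 1
  refine Finset.sum_congr rfl fun j _ => ?_
  rcases lt_or_ge j i with hj | hj
  · rw [h.eq_of_transform_eq hw j hj]
  · rw [h.functional_zero i j hj]
    rfl

/-- Each operator `T i j` produces a wave with zero trace at `x = 0`, source `-g_ij a_j` and trace
`R i j` at `x = 1`. Subtracting these supplies the missing sources, fixes the control, and leaves
everything read at `x = 0` as it was. -/
lemma isWeakSolution (hlam : IsSpeedFamily lam) (hG : IsCascadeMatrix G)
    {Q : Matrix (Fin p) (Fin m) ℝ} {z : ℝ → State m p}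
    (hz : IsWeakSolution lam (reducedMatrix G) Q 0 z) :
    IsWeakSolution lam G Q H fun t => F (z t) := by
  obtain ⟨hcont, a, b, hab, hw, hb, ha⟩ := hz
  have hFc : ContinuousOn (fun t => F (z t)) (Ici 0) := F.continuous.comp_continuousOn hcont
  have hred : ∀ i j, MemLp (reducedMatrix G i j) ⊤ unitMeasure := by
    rintro (i | k) (j | l)
    · exact MemLp.zero'
    · exact MemLp.zero'
    · exact hG.memLp _ _
    · exact MemLp.zero'
  -- The left traces are those of `z`. The right traces of the negative components are defined by
  -- the control itself, so the boundary condition is immediate and the weak form is what has to be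
  -- verified.
  refine ⟨hFc, a, Sum.elim (fun i t => H (F (z t)) i) (fun k => b (Sum.inr k)), ?_, ?_,
    .of_forall fun t i => rfl, ha⟩
  · rintro (i | k) T
    · exact ⟨(hab _ T).1, memLp_of_continuousOn ((continuous_apply i).comp_continuousOn
        (H.continuous.comp_continuousOn hFc)) T⟩
    · exact hab _ T
  · have htr : ∀ i : Fin m, IsTransport (lam (Sum.inl i)) (fun t => z t (Sum.inl i)) (a (Sum.inl i))
        (b (Sum.inl i)) fun _ _ => 0 := fun i => by
      simpa [reducedMatrix] using isTransport_of_weak hred hcont hab (hw (Sum.inl i))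
    have hb0 : ∀ i : Fin m, ∀ᵐ t ∂volume.restrict (Ioi (0 : ℝ)), b (Sum.inl i) t = 0 := fun i =>
      hb.mono fun t ht => by simpa using ht i
    rintro (i | k)
    · have hsum := (htr i).add_sum_smul (hlam.contDiffOn _) Finset.univ (fun _ => -1)
        (v := fun j t => T i j (z t (Sum.inl j))) (α := fun _ _ => 0)
        (β := fun j t => R i j (z t (Sum.inl j)))
        (g := fun j t x => -(G (Sum.inl i) (Sum.inl j) x * a (Sum.inl j) t)) fun j _ => by
          rcases lt_or_ge j i with hj | hj
          · exact (htr j).cascade (hlam.isSpeed_inl i) (hlam.neg i) (hlam.isSpeed_inl j)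
              (hlam.neg j) (hlam.contDiffOn _) (hlam.contDiffOn _) (hG.memLp _ _)
              (h.operator_eq i j hj) (h.functional_eq i j hj) (hb0 j)
          -- On and above the diagonal the operator, functional and coefficient all vanish, so the
          -- zero solution fills the summand.
          · simpa [h.operator_zero i j hj, h.functional_zero i j hj, hG.upper_eq_zero i j hj]
              using isTransport_zero (lam (Sum.inl i))
      refine hsum.weak.congr (fun t _ => ?_) (.of_forall fun t => by simp) ?_
        (.of_forall fun t => ?_)
      · simp [h.transform_inl, sub_eq_add_neg]
      · filter_upwards [hb0 i] with t ht
        simp [ht, h.control]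
      · ext x
        simp [Fintype.sum_sum_type, hG.right_eq_zero]
    · refine (hw (Sum.inr k)).congr (fun t _ => (h.transform_inr _ _).symm)
        (.of_forall fun t => rfl) (.of_forall fun t => rfl) (.of_forall fun t => ?_)
      ext x
      simp [Fintype.sum_sum_type, hG.right_eq_zero, reducedMatrix]

end IsCascadeTransform

/-! ### The matrix kernel and the theorem. -/

open Classical in
/-- The kernel of the Fredholm transform. -/
def transformKernel (lam : Idx m p → ℝ → ℝ) (G : Idx m p → Idx m p → ℝ → ℝ) :
    Idx m p → Idx m p → ℝ → ℝ → ℝ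
  | Sum.inl i, Sum.inl j => if j < i then
      cascadeKernel (lam (Sum.inl i)) (lam (Sum.inl j)) (G (Sum.inl i) (Sum.inl j)) else fun _ _ => 0
  | Sum.inr _, _ => fun _ _ => 0
  | Sum.inl _, Sum.inr _ => fun _ _ => 0

lemma memLp_transformKernel (hlam : IsSpeedFamily lam) (hG : IsCascadeMatrix G) (i j : Idx m p) :
    MemLp (fun q : ℝ × ℝ => transformKernel lam G i j q.1 q.2) 2
      (unitMeasure.prod unitMeasure) := by
  rcases i with i | k
  · rcases j with j | l
    · by_cases h : j < i
      · simpa [transformKernel, h] using memLp_cascadeKernel (hlam.isSpeed_inl i) (hlam.neg i)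
          (hlam.isSpeed_inl j) (hlam.neg j) (hG.memLp (Sum.inl i) (Sum.inl j))
      · simp [transformKernel, h]
    · simp [transformKernel]
  · simp [transformKernel]

lemma IsCascadeTransform.ae_eq_sub_integral
    {T : Fin m → Fin m → Lp ℝ 2 unitMeasure →L[ℝ] Lp ℝ 2 unitMeasure}
    {R : Fin m → Fin m → Lp ℝ 2 unitMeasure →L[ℝ] ℝ} {F : State m p ≃L[ℝ] State m p}
    {H : State m p →L[ℝ] (Fin m → ℝ)} (h : IsCascadeTransform lam G T R F H) (z : State m p)
    (i : Idx m p) : ∀ᵐ x ∂unitMeasure,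
      F z i x = z i x - ∑ j, ∫ y, transformKernel lam G i j x y * z j y ∂unitMeasure := by
  rcases i with i | k
  · have hT : ∀ j : Fin m, ∀ᵐ x ∂unitMeasure, T i j (z (Sum.inl j)) x =
        ∫ y, transformKernel lam G (Sum.inl i) (Sum.inl j) x y * z (Sum.inl j) y ∂unitMeasure := by
      intro j
      rcases lt_or_ge j i with hj | hj
      · simp only [transformKernel, if_pos hj]
        exact h.operator_eq i j hj (z (Sum.inl j))
      · rw [h.operator_zero i j hj, zero_apply]
        exact .of_forall fun x => by simp [transformKernel, hj.not_gt]
    rw [h.transform_inl]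
    filter_upwards [Lp.coeFn_sub (z (Sum.inl i)) (∑ j, T i j (z (Sum.inl j))),
      Lp.coeFn_fun_finsetSum Finset.univ (fun j => T i j (z (Sum.inl j))), ae_all_iff.2 hT]
      with x h1 h2 h3
    rw [h1, Pi.sub_apply, h2]
    simp [Fintype.sum_sum_type, transformKernel, h3]
  · rw [h.transform_inr]
    simp [transformKernel]

end System

end HyperbolicFredholm

end

open HyperbolicFredholm in
theorem proposition2p3 (m p : ℕ) (hm : 1 ≤ m) (hp : 1 ≤ p)
    (lam : Idx m p → ℝ → ℝ) (hlam : IsSpeedFamily lam)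
    (Q : Matrix (Fin p) (Fin m) ℝ)
    (G : Idx m p → Idx m p → ℝ → ℝ) (hG : IsCascadeMatrix G) :
    ∃ K : Idx m p → Idx m p → ℝ → ℝ → ℝ,
      -- square-integrable kernel, strictly lower triangular, supported in the first block
      (∀ i j, MemLp (fun q : ℝ × ℝ => K i j q.1 q.2) 2 (unitMeasure.prod unitMeasure)) ∧
      (∀ (k : Fin p) (j : Idx m p) (x y : ℝ), K (Sum.inr k) j x y = 0) ∧
      (∀ (i : Idx m p) (l : Fin p) (x y : ℝ), K i (Sum.inr l) x y = 0) ∧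
      (∀ i j : Fin m, i ≤ j → ∀ x y : ℝ, K (Sum.inl i) (Sum.inl j) x y = 0) ∧
      -- explicit formula along the characteristics
      (∀ i j : Fin m, j < i → ∀ x ∈ Icc (0 : ℝ) 1, ∀ y ∈ Icc (0 : ℝ) 1,
        (travel (lam (Sum.inl i)) x ≤ travel (lam (Sum.inl j)) y →
          K (Sum.inl i) (Sum.inl j) x y =
            G (Sum.inl i) (Sum.inl j) (travelInv (lam (Sum.inl i))
              (travel (lam (Sum.inl i)) x - travel (lam (Sum.inl j)) y))
              / (- lam (Sum.inl j) y)) ∧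
        (travel (lam (Sum.inl j)) y < travel (lam (Sum.inl i)) x →
          K (Sum.inl i) (Sum.inl j) x y = 0)) ∧
      ∃ (F : State m p ≃L[ℝ] State m p) (H : State m p →L[ℝ] (Fin m → ℝ)),
        -- `F = I - ∫₀¹ K(·,y) · dy`
        (∀ (z : State m p) (i : Idx m p), ∀ᵐ x ∂unitMeasure,
          F z i x = z i x - ∑ j, ∫ y, K i j x y * z j y ∂unitMeasure) ∧
        -- `F` maps the solution of the target system to the solution of the original one
        (∀ (γ₀ : State m p) (z : ℝ → State m p),
          IsWeakSolution lam (reducedMatrix G) Q 0 z → z 0 = F.symm γ₀ →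
            IsWeakSolution lam G Q H (fun t => F (z t)) ∧ F (z 0) = γ₀ ∧
            ∀ γ : ℝ → State m p, IsWeakSolution lam G Q H γ → γ 0 = γ₀ →
              ∀ t, 0 ≤ t → γ t = F (z t)) := by
  obtain ⟨T, R, F, H, h⟩ := exists_cascadeTransform hlam hG
  refine ⟨transformKernel lam G, memLp_transformKernel hlam hG, fun k j x y => ?_,
    fun i l x y => ?_, fun i j hij x y => ?_, fun i j hji x hx y hy => ⟨fun hxy => ?_,
    fun hxy => ?_⟩, F, H, h.ae_eq_sub_integral, fun γ₀ z hz hz0 => ?_⟩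
  · simp [transformKernel]
  · rcases i with i | k <;> simp [transformKernel]
  · simp [transformKernel, hij.not_gt]
  · simpa [transformKernel, hji] using cascadeKernel_eq (hlam.isSpeed_inl i) (hlam.neg i)
      (hlam.isSpeed_inl j) (hlam.neg j) (G (Sum.inl i) (Sum.inl j)) hx hy hxy
  · simpa [transformKernel, hji] using cascadeKernel_eq_zero (lam (Sum.inl i)) (lam (Sum.inl j))
      (G (Sum.inl i) (Sum.inl j)) hx hy hxy
  · have hsol := h.isWeakSolution hlam hG hz
    have h0 : F (z 0) = γ₀ := by rw [hz0, F.apply_symm_apply]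
    exact ⟨hsol, h0, fun γ hγ hγ0 t ht =>
      hγ.eq_of_initial_eq hlam hG h.control_congr hsol (hγ0.trans h0.symm) ht⟩
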